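/- Let $0<s_1<s_2<s_3$ with $s_1+s_2+s_3=1$, and let $S=\mathrm{diag}(s_1,s_2,s_3)$. Identify a triple $f=(f_1,f_2,f_3)\in\mathbb R^3$ with the matrix $\mathrm{diag}(f_1,f_2,f_3)$. Let $\mathcal H\subset\mathbb R^3$ be the closed hexagon with vertices at the permutations of $(s_1,s_2,s_3)$; it lies in the unit-trace plane $\{m_1+m_2+m_3=1\}$. **Rank-one curves.** For $F$, $G$ diagonal of unit trace, $\lambda\in\mathbb R\setminus\{1\}$, $R\in SO(3)$ and a unit vector $n$ with $R^tGR=\lambda F+(1-\lambda)\,n\otimes n$, put $$M_{F,G}(\lambda,t)=\eta F+(1-\eta)\,n\otimes n,\qquad \eta=\eta(\lambda,t)=\frac{\lambda}{\lambda+t(1-\lambda)},\qquad t\in[0,1];$$ this is the segment from $\lambda F$ to $R^tGR$, rescaled to unit trace. Let $m_{F,G}(\lambda,t)$ be the triple of eigenvalues of $M_{F,G}(\lambda,t)$ in increasing order. **The set $\mathcal L$.** Let $u_\alpha<u_\beta$ be the two roots of $b(x)=6s_2x^2+(s_1s_3-3s_2-4s_2^2)x+2s_2^2$, and put $U_\alpha=\mathrm{diag}(u_\alpha,u_\alpha,1-2u_\alpha)$,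 $U_\beta=\mathrm{diag}(1-2u_\beta,u_\beta,u_\beta)$, $\alpha=u_\alpha/s_2$, $\beta=u_\beta/s_2$. Let $$\Gamma_\alpha=\{m_{S,U_\alpha}(\alpha,t):t\in[0,1]\},\qquad \Gamma_\beta=\{m_{S,U_\beta}(\beta,t):t\in[0,1]\},$$ where the unit vector $n$ used for the pair $(F,G)=(S,U_\alpha)$, $\lambda=\alpha$ (respectively $(S,U_\beta)$, $\lambda=\beta$) is given, up to signs of its components that do not affect the eigenvalues, by $$n_i^2=\frac{\prod_{j=1}^3(g_j-\lambda f_i)}{\lambda^2(1-\lambda)\prod_{j\ne i}(f_j-f_i)},\qquad i=1,2,3,$$ $f_i$ and $g_i$ being the diagonal entries of $F$ and $G$. Let $\Gamma$ be the closed curve formed by $\Gamma_\alpha$, its reflection in the line $m_1=m_2$ of the unit-trace plane, $\Gamma_\beta$, its reflection in the line $m_2=m_3$, and the images of these four arcs under the rotations by $2\pi/3$ and $4\pi/3$ of the unit-trace plane about $(\frac13,\frac13,\frac13)$ (the cyclic permutations of the coordinates). Let $\mathcal L$ be the subset of $\mathcal H$ enclosed by $\Gamma$, i.e. the set of points of $\mathcal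 H$ that lie on $\Gamma$ or in a bounded connected component of the complement of $\Gamma$ in the unit-trace plane. **Theorem.** The set $\mathcal L$ is stable under lamination: if $F,G\in\mathcal L$, $\lambda\in\mathbb R$ and $R\in SO(3)$ are such that $\operatorname{rank}(\lambda F-R^tGR)=1$, then $R^tGR=\lambda F+(1-\lambda)\,n\otimes n$ for some unit vector $n$ (unique up to sign), and $m_{F,G}(\lambda,t)\in\mathcal L$ for every $t\in[0,1]$. -/

import Mathlib

open scoped Matrix

noncomputable section

namespace Polycrystal

/-- `m = (m₀, m₁, m₂)` is the triple of ordered eigenvalues (repeated according to multiplicity)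
of the symmetric matrix `M`. -/
def IsOrderedEigenvalues (M : Matrix (Fin 3) (Fin 3) ℝ) (m : Fin 3 → ℝ) : Prop :=
  Monotone m ∧ M.charpoly = ∏ i, (Polynomial.X - Polynomial.C (m i))

/-- The plane of triples with unit trace. -/
def unitTracePlane : Set (Fin 3 → ℝ) := {m | m 0 + m 1 + m 2 = 1}

/-- The closed hexagon whose vertices are the permutations of the triple `s`. -/
def hexagon (s : Fin 3 → ℝ) : Set (Fin 3 → ℝ) :=
  convexHull ℝ {m | ∃ σ : Equiv.Perm (Fin 3), m = s ∘ σ}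

/-- `η(lam, t) = lam / (lam + t (1 - lam))`. -/
def eta (lam t : ℝ) : ℝ := lam / (lam + t * (1 - lam))

/-- The unit-trace family `M(lam, t) = η F + (1 - η) n ⊗ n`, where `F = diag f`. When
`Rᵀ G R = lam F + (1 - lam) n ⊗ n`, with `F` and `G` of unit trace, it is the rank-one segment
from `lam F` to `Rᵀ G R`, each of its points being divided by its trace. -/
def rankOneCurve (f n : Fin 3 → ℝ) (lam t : ℝ) : Matrix (Fin 3) (Fin 3) ℝ :=
  eta lam t • Matrix.diagonal f + (1 - eta lam t) • Matrix.vecMulVec n n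

/-- The vector `n` of nonnegative components solving
`Rᵀ (diag g) R = lam (diag f) + (1 - lam) n ⊗ n`, for `f` with distinct entries:
`nᵢ² = ∏ⱼ (gⱼ - lam fᵢ) / (lam² (1 - lam) ∏_{j ≠ i} (fⱼ - fᵢ))`. -/
def connectionNormal (f g : Fin 3 → ℝ) (lam : ℝ) (i : Fin 3) : ℝ :=
  Real.sqrt ((∏ j, (g j - lam * f i)) /
    (lam ^ 2 * (1 - lam) * ∏ j ∈ Finset.univ.erase i, (f j - f i)))

/-- The quadratic polynomial whose roots are `u_α < u_β`. -/
def quadB (s : Fin 3 → ℝ) (x : ℝ) : ℝ :=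
  6 * s 1 * x ^ 2 + x * (s 0 * s 2 - 3 * s 1 - 4 * s 1 ^ 2) + 2 * s 1 ^ 2

/-- The smallest root of `quadB s`. -/
def uAlpha (s : Fin 3 → ℝ) : ℝ := sInf {x | quadB s x = 0}

/-- The largest root of `quadB s`. -/
def uBeta (s : Fin 3 → ℝ) : ℝ := sSup {x | quadB s x = 0}

/-- The eigenvalues of the uniaxial matrix `U_α = diag (u_α, u_α, 1 - 2 u_α)`. -/
def UAlpha (s : Fin 3 → ℝ) : Fin 3 → ℝ := ![uAlpha s, uAlpha s, 1 - 2 * uAlpha s]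

/-- The eigenvalues of the uniaxial matrix `U_β = diag (1 - 2 u_β, u_β, u_β)`. -/
def UBeta (s : Fin 3 → ℝ) : Fin 3 → ℝ := ![1 - 2 * uBeta s, uBeta s, uBeta s]

/-- The curve of ordered eigenvalues of `M_{F,G}(lam, t)`, `0 ≤ t ≤ 1`, for `F = diag f` with
distinct eigenvalues and `G = diag g`. -/
def eigenvalueCurve (f g : Fin 3 → ℝ) (lam : ℝ) : Set (Fin 3 → ℝ) :=
  {m | ∃ t ∈ Set.Icc (0 : ℝ) 1,
    IsOrderedEigenvalues (rankOneCurve f (connectionNormal f g lam) lam t) m}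

/-- `Γ_α`: the curve from `S` to `U_α`, with `lam = α = u_α / s₂`. -/
def GammaAlpha (s : Fin 3 → ℝ) : Set (Fin 3 → ℝ) :=
  eigenvalueCurve s (UAlpha s) (uAlpha s / s 1)

/-- `Γ_β`: the curve from `S` to `U_β`, with `lam = β = u_β / s₂`. -/
def GammaBeta (s : Fin 3 → ℝ) : Set (Fin 3 → ℝ) :=
  eigenvalueCurve s (UBeta s) (uBeta s / s 1)

/-- The union of `A` and its mirror image in the line `mᵢ = mⱼ` of the unit-trace plane; the
reflection exchanges the coordinates `i` and `j`. -/
def withReflection (i j : Fin 3) (A : Set (Fin 3 → ℝ)) : Set (Fin 3 → ℝ) :=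
  A ∪ {m | m ∘ Equiv.swap i j ∈ A}

/-- The union of the three rotated copies of `A` by multiples of `2π/3` within the unit-trace
plane; these rotations are the cyclic permutations of the coordinates. -/
def withRotations (A : Set (Fin 3 → ℝ)) : Set (Fin 3 → ℝ) :=
  {m | ∃ k : Fin 3, m ∘ ((finRotate 3) ^ (k : ℕ)) ∈ A}

/-- The closed curve `Γ`. -/
def Gamma (s : Fin 3 → ℝ) : Set (Fin 3 → ℝ) :=
  withRotations (withReflection 0 1 (GammaAlpha s)) ∪
    withRotations (withReflection 1 2 (GammaBeta s))

/-- The subset of the hexagon enclosed by `Γ`: the points of `Γ` and those in a bounded connected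
component of the complement of `Γ` in the unit-trace plane. -/
def enclosedSet (s : Fin 3 → ℝ) : Set (Fin 3 → ℝ) :=
  {m | m ∈ hexagon s ∧ (m ∈ Gamma s ∨
    (m ∈ unitTracePlane \ Gamma s ∧
      Bornology.IsBounded (connectedComponentIn (unitTracePlane \ Gamma s) m)))}

/-- Stability under lamination of a set `L` of triples of unit sum, a triple `f` being identified
with the matrix `diag f`: whenever `F, G ∈ L` and `lam F - Rᵀ G R` has rank one, with `R ∈ SO(3)`,
one has `Rᵀ G R = lam F + (1 - lam) n ⊗ n` for a unit vector `n` (unique up to sign), and the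
ordered eigenvalues of `M_{F,G}(lam, t)` belong to `L` for all `t ∈ [0, 1]`. -/
def StableUnderLamination (L : Set (Fin 3 → ℝ)) : Prop :=
  ∀ f ∈ L, ∀ g ∈ L, ∀ lam : ℝ, ∀ R ∈ Matrix.specialOrthogonalGroup (Fin 3) ℝ,
    (lam • Matrix.diagonal f - Rᵀ * Matrix.diagonal g * R).rank = 1 →
    ∃ n : Fin 3 → ℝ, n ⬝ᵥ n = 1 ∧
      Rᵀ * Matrix.diagonal g * R
        = lam • Matrix.diagonal f + (1 - lam) • Matrix.vecMulVec n n ∧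
      ∀ t ∈ Set.Icc (0 : ℝ) 1, ∃ m ∈ L, IsOrderedEigenvalues (rankOneCurve f n lam t) m

end Polycrystal

end

/-!
The proof describes the enclosed set by two inequalities, each of which is preserved along rank-one
segments.

For a triple `m` in increasing order, with sum `T` and second elementary symmetric function `e`, put
`gap u m = u e + (2 - 3 u) m₁ (m₁ - 2 u T)`; for `T = 1` this is
`u m₀ m₂ - m₁ (1 - 2 u) (3 u - 2 m₁)`. In the coordinates `(m₁, m₀ m₂ / m₁)` its zero set is the line
through the uniaxial triple of parameter `u` that also passes through `s` when `quadB s u = 0`. The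
middle eigenvector of `S` stays an eigenvector along the arcs `Γ_α` and `Γ_β`, and this makes them
segments of the lines for `u = u_α` and `u = u_β` (`mem_eigenvalueCurve_iff`). In these coordinates
an increasing triple is enclosed by `Γ` when it lies in the triangle cut out by the two lines and
the line `y = 1 - 2 x` of the uniaxial triples.

To prove `enclosedSet_eq_admissibleSet`, i.e. that the enclosed set is the part of the hexagon where
both gaps are nonnegative, let `K` be the region `gapSet` of positive triples of nonnegative gaps. It
contains `Γ`, its boundary lies in `Γ`, and it is bounded, so the components of the complement of
`Γ` that meet `K` are bounded. It is star-shaped about the isotropic triple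
(`gap_contraction_nonneg`), so a point outside `K` is joined to infinity by a ray that avoids `Γ`.

Stability has two parts. The bounds `s₀ ≤ mᵢ ≤ s₂` of the hexagon (`mem_hexagon_iff`) persist because
the normalized segment consists of convex combinations of its endpoints. For the gaps
(`gapAt_nonneg_of_pencil`), undo the normalization of the trace: along `A + c n ⊗ n` the
characteristic polynomial at a fixed `z` is affine in `c`, and so is the gap with the middle
eigenvalue replaced by `z`. Taking for `z` the middle eigenvalue at an intermediate point, the
characteristic polynomial vanishes there, which fixes the ratio of its values at the two ends, and the
claim becomes an inequality between the data at the two ends. Dividing both cubics by their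
approximate middle factor reduces it to the elementary estimate `redFactor_comparison`; of the
interlacing of eigenvalues, only three inequalities are used.
-/

noncomputable section

namespace Polycrystal

/-! ### The quadratic gap function -/

/-- The quadratic gap `u e + (2 - 3u) z (z - 2 u T)` of a triple with sum `T` and second elementary
symmetric function `e`, evaluated at `z` in place of the middle entry of the triple. -/
def gapAt (u T e z : ℝ) : ℝ := u * e + (2 - 3 * u) * z * (z - 2 * u * T)

/-- The reduced quadratic factor `(2u) (z - f₀) (z - f₂)` of the cubic with roots `f₀, x, f₂`, when
the gap of this triple vanishes and `p = 2 u T - x` is the second zero of the gap. -/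
def redFactor (u z x p : ℝ) : ℝ :=
  (z - 3 * (1 - 2 * u) * x) * (z - p) - (1 - 2 * u) * (z - x) ^ 2

lemma gapAt_sub (u T e z x : ℝ) :
    gapAt u T e z = gapAt u T e x + (2 - 3 * u) * (z - x) * (z + x - 2 * u * T) := by
  unfold gapAt; ring

/-- Division of a cubic by `z - x`: the quotient is, up to the factor `2u`, the reduced factor corrected
by the gap, and the remainder is the value at `x`. -/
lemma cubic_eq_redFactor (u T e d z x : ℝ) :
    2 * u * (z ^ 3 - T * z ^ 2 + e * z - d) =
      (z - x) * (redFactor u z x (2 * u * T - x) + 2 * gapAt u T e x)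
        + 2 * u * (x ^ 3 - T * x ^ 2 + e * x - d) := by
  unfold gapAt redFactor; ring

lemma exists_gapAt_root {u T e z y : ℝ} (hzy : z ≤ y)
    (hz : gapAt u T e z < 0) (hy : 0 ≤ gapAt u T e y) :
    ∃ w, z < w ∧ w ≤ y ∧ gapAt u T e w = 0 := by
  have hc : ContinuousOn (fun z => gapAt u T e z) (Set.Icc z y) := by
    unfold gapAt; fun_prop
  obtain ⟨w, hw, hw0⟩ := intermediate_value_Icc hzy hc ⟨hz.le, hy⟩
  refine ⟨w, lt_of_le_of_ne hw.1 ?_, hw.2, hw0⟩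
  rintro rfl
  simp only at hw0
  linarith

/-- The reduced factors at the two ends of a pencil, relative to the other zeros `p` and `q` of the
gaps. After division by `(z - p) (z - q)` the terms of `redFactor` that depend on `z` alone cancel. -/
lemma redFactor_comparison {u z x p w q : ℝ} (hu' : u < 1 / 2)
    (hxz : x ≤ z) (hpx : p ≤ x) (hzw : z < w) (hqz : q < z) :
    redFactor u z w q * (z - p) ≤ redFactor u z x p * (z - q) := by
  have key : redFactor u z x p * (z - q) - redFactor u z w q * (z - p) =
      (1 - 2 * u) * ((z - q) * (3 * (w - x) * (z - p) - (z - x) ^ 2)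
        + (z - w) ^ 2 * (z - p)) := by
    unfold redFactor; ring
  have h1 : (z - x) ^ 2 ≤ 3 * (w - x) * (z - p) := by nlinarith
  have h2 : 0 ≤ (z - w) ^ 2 * (z - p) := mul_nonneg (sq_nonneg _) (by linarith)
  have h3 : 0 ≤ (z - q) * (3 * (w - x) * (z - p) - (z - x) ^ 2) :=
    mul_nonneg (by linarith) (by linarith)
  have h4 : 0 ≤ (1 - 2 * u) * ((z - q) * (3 * (w - x) * (z - p) - (z - x) ^ 2)
        + (z - w) ^ 2 * (z - p)) := mul_nonneg (by linarith) (by linarith)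
  linarith

/-- Let the cubic with roots `x₀, x₁, x₂` be a convex combination of the cubics with roots `fᵢ` and
`gᵢ`. If the gaps of `f` and `g` are nonnegative, and their middle entries lie on the increasing
branch of the gap, then the gap of `x` is nonnegative. The remaining hypotheses hold for
the eigenvalues of `A`, `A + τ c n ⊗ n` and `A + c n ⊗ n` when `A` is positive and `u < 1/3`; no
sign of the roots is assumed, so that the statement also applies to opposite matrices. -/
theorem gapAt_nonneg_of_pencil {u τ f₀ f₁ f₂ x₀ x₁ x₂ g₀ g₁ g₂ : ℝ}
    (hu : 0 < u) (hu' : u < 1 / 2) (hτ : 0 ≤ τ) (hτ' : τ ≤ 1)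
    (hpen : ∀ z, (z - x₀) * (z - x₁) * (z - x₂) =
      (1 - τ) * ((z - f₀) * (z - f₁) * (z - f₂)) + τ * ((z - g₀) * (z - g₁) * (z - g₂)))
    (hfx : f₁ ≤ x₁) (hgf : g₀ ≤ f₁) (hg : g₁ ≤ g₂)
    (hsgn : (3 * u - 1) * x₁ ≤ 0)
    (hF : 0 ≤ gapAt u (f₀ + f₁ + f₂) (f₀ * f₁ + f₀ * f₂ + f₁ * f₂) f₁)
    (hG : 0 ≤ gapAt u (g₀ + g₁ + g₂) (g₀ * g₁ + g₀ * g₂ + g₁ * g₂) g₁)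
    (hF' : u * (f₀ + f₁ + f₂) ≤ f₁) (hG' : u * (g₀ + g₁ + g₂) ≤ g₁) :
    0 ≤ gapAt u (x₀ + x₁ + x₂) (x₀ * x₁ + x₀ * x₂ + x₁ * x₂) x₁ := by
  have a0 := hpen 0
  have a1 := hpen 1
  have a2 := hpen (-1)
  have hT : x₀ + x₁ + x₂ = (1 - τ) * (f₀ + f₁ + f₂) + τ * (g₀ + g₁ + g₂) := by
    linear_combination (-1 / 2) * a1 - (1 / 2) * a2 + a0
  have hE : x₀ * x₁ + x₀ * x₂ + x₁ * x₂ = (1 - τ) * (f₀ * f₁ + f₀ * f₂ + f₁ * f₂)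
      + τ * (g₀ * g₁ + g₀ * g₂ + g₁ * g₂) := by
    linear_combination (1 / 2) * a1 - (1 / 2) * a2
  have hz := hpen x₁
  set z := x₁ with hzdef
  clear_value z
  set TF := f₀ + f₁ + f₂ with hTF
  set eF := f₀ * f₁ + f₀ * f₂ + f₁ * f₂ with heF
  set TG := g₀ + g₁ + g₂ with hTG
  set eG := g₀ * g₁ + g₀ * g₂ + g₁ * g₂ with heG
  have hk : 0 < 2 - 3 * u := by linarith
  have hsplit : gapAt u (x₀ + z + x₂) (x₀ * z + x₀ * x₂ + z * x₂) z =
      (1 - τ) * gapAt u TF eF z + τ * gapAt u TG eG z := by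
    rw [hT, hE]; unfold gapAt; ring
  rw [hsplit]
  have hΛF : (2 - 3 * u) * (z - f₁) * (z - (2 * u * TF - f₁)) ≤ gapAt u TF eF z := by
    have := gapAt_sub u TF eF z f₁
    have e : (2 - 3 * u) * (z - f₁) * (z - (2 * u * TF - f₁)) =
      (2 - 3 * u) * (z - f₁) * (z + f₁ - 2 * u * TF) := by ring
    linarith
  have hp : 2 * u * TF - f₁ ≤ f₁ := by linarith
  have hΛF0 : 0 ≤ gapAt u TF eF z :=
    le_trans (mul_nonneg (mul_nonneg hk.le (by linarith)) (by linarith)) hΛF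
  rcases le_or_gt 0 (gapAt u TG eG z) with hΛG | hΛG
  · exact add_nonneg (mul_nonneg (by linarith) hΛF0) (mul_nonneg hτ hΛG)
  -- the gap of `g` increases to the right of `u TG`, so its larger zero lies in `(z, g₁]`; using
  -- this zero `w` instead of `g₁` makes the factorization of the gap exact
  have hzg : z ≤ g₁ := by
    by_contra hcon
    push Not at hcon
    have := gapAt_sub u TG eG z g₁
    have : 0 ≤ (2 - 3 * u) * (z - g₁) * (z + g₁ - 2 * u * TG) :=
      mul_nonneg (mul_nonneg hk.le (by linarith)) (by linarith)
    linarith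
  obtain ⟨w, hzw, hwg, hw0⟩ := exists_gapAt_root hzg hΛG hG
  have hΛG' : gapAt u TG eG z = (2 - 3 * u) * (z - w) * (z - (2 * u * TG - w)) := by
    have := gapAt_sub u TG eG z w
    linear_combination this + hw0
  set p := 2 * u * TF - f₁ with hpdef
  set q := 2 * u * TG - w with hqdef
  have hqz : q < z := by
    by_contra hcon
    push Not at hcon
    have : 0 ≤ (2 - 3 * u) * (w - z) * (q - z) :=
      mul_nonneg (mul_nonneg hk.le (by linarith)) (by linarith)
    linarith [hΛG', this, show (2 - 3 * u) * (w - z) * (q - z)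
      = (2 - 3 * u) * (z - w) * (z - q) by ring]
  have hcmp := redFactor_comparison hu' hfx hp hzw hqz
  -- strict negativity here excludes the case in which the cubic of `g` vanishes at `z`, where
  -- the pencil would give no information on `τ`
  have hGneg : redFactor u z w q < 0 := by
    have h1 : z - 3 * (1 - 2 * u) * w < 0 := by
      have : 0 < (1 - 2 * u) * (w - z) := mul_pos (by linarith) (by linarith)
      linarith
    have h2 : (z - 3 * (1 - 2 * u) * w) * (z - q) < 0 := mul_neg_of_neg_of_pos h1 (by linarith)
    have h3 : 0 ≤ (1 - 2 * u) * (z - w) ^ 2 := mul_nonneg (by linarith) (sq_nonneg _)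
    unfold redFactor; linarith
  have hPF : 2 * u * ((z - f₀) * (z - f₁) * (z - f₂)) =
      (z - f₁) * (redFactor u z f₁ p + 2 * gapAt u TF eF f₁) := by
    have := cubic_eq_redFactor u TF eF (f₀ * f₁ * f₂) z f₁
    rw [hTF, heF] at *
    linear_combination this
  have hPG : 2 * u * ((z - g₀) * (z - g₁) * (z - g₂)) =
      (z - w) * redFactor u z w q + 2 * u * ((w - g₀) * (w - g₁) * (w - g₂)) := by
    have := cubic_eq_redFactor u TG eG (g₀ * g₁ * g₂) z w
    rw [hw0] at this
    rw [hTG, heG] at *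
    linear_combination this
  have hPGw : 0 ≤ (w - g₀) * (w - g₁) * (w - g₂) := by
    have : 0 ≤ (w - g₀) * ((g₁ - w) * (g₂ - w)) :=
      mul_nonneg (by linarith) (mul_nonneg (by linarith) (by linarith))
    linarith [this, show (w - g₀) * ((g₁ - w) * (g₂ - w))
      = (w - g₀) * (w - g₁) * (w - g₂) by ring]
  set PF := (z - f₀) * (z - f₁) * (z - f₂) with hPFdef
  set PG := (z - g₀) * (z - g₁) * (z - g₂) with hPGdef
  have hPG1 : (w - z) * (-redFactor u z w q) ≤ 2 * u * PG := by
    rw [hPG]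
    have : 0 ≤ 2 * u * ((w - g₀) * (w - g₁) * (w - g₂)) := mul_nonneg (by linarith) hPGw
    linarith
  have hPG0 : 0 < 2 * u * PG := lt_of_lt_of_le (mul_pos (by linarith) (by linarith)) hPG1
  have hPF1 : (z - f₁) * redFactor u z f₁ p ≤ 2 * u * PF := by
    rw [hPF]
    have : 0 ≤ (z - f₁) * (2 * gapAt u TF eF f₁) := mul_nonneg (by linarith) (by linarith)
    linarith
  have hD1 : (w - z) * (-redFactor u z w q) * ((2 - 3 * u) * (z - f₁) * (z - p)) ≤
      2 * u * PG * gapAt u TF eF z :=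
    mul_le_mul hPG1 hΛF (mul_nonneg (mul_nonneg hk.le (by linarith)) (by linarith)) hPG0.le
  have hD2 : (z - f₁) * redFactor u z f₁ p * (-gapAt u TG eG z) ≤
      2 * u * PF * (-gapAt u TG eG z) :=
    mul_le_mul_of_nonneg_right hPF1 (by linarith)
  have hD3 : 0 ≤ (2 - 3 * u) * (w - z) * (z - f₁) *
      (redFactor u z f₁ p * (z - q) - redFactor u z w q * (z - p)) :=
    mul_nonneg (mul_nonneg (mul_nonneg hk.le (by linarith)) (by linarith)) (by linarith)
  have hD : 0 ≤ 2 * u * PG * gapAt u TF eF z - 2 * u * PF * gapAt u TG eG z := by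
    rw [hΛG'] at hD2 ⊢
    linarith [show (w - z) * (-redFactor u z w q) * ((2 - 3 * u) * (z - f₁) * (z - p)) +
      (z - f₁) * redFactor u z f₁ p * (-((2 - 3 * u) * (z - w) * (z - q))) =
      (2 - 3 * u) * (w - z) * (z - f₁) *
      (redFactor u z f₁ p * (z - q) - redFactor u z w q * (z - p)) by ring]
  have hz' : τ * PG = -(1 - τ) * PF := by
    linear_combination -hz
  have hfin : 2 * u * PG * ((1 - τ) * gapAt u TF eF z + τ * gapAt u TG eG z) =
      (1 - τ) * (2 * u * PG * gapAt u TF eF z - 2 * u * PF * gapAt u TG eG z) := by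
    linear_combination 2 * u * gapAt u TG eG z * hz'
  have h0 : 0 ≤ 2 * u * PG * ((1 - τ) * gapAt u TF eF z + τ * gapAt u TG eG z) := by
    rw [hfin]; exact mul_nonneg (by linarith) hD
  exact nonneg_of_mul_nonneg_right h0 hPG0

/-! ### Triples and their middle entry -/

/-- The middle entry of a triple. -/
def med (m : Fin 3 → ℝ) : ℝ := max (min (m 0) (m 1)) (min (max (m 0) (m 1)) (m 2))

/-- The gap of a triple, evaluated at its middle entry. For a positive increasing triple of unit sum
it has the sign of `y - (1 - 2 u) (3 - 2 m₁ / u)`, where `y = m₀ m₂ / m₁`, provided that `u > 0`; so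
it tells on which side of a line the point `(m₁, y)` lies. -/
def gap (u : ℝ) (m : Fin 3 → ℝ) : ℝ :=
  gapAt u (m 0 + m 1 + m 2) (m 0 * m 1 + m 0 * m 2 + m 1 * m 2) (med m)

lemma med_eq_of_monotone {m : Fin 3 → ℝ} (hm : Monotone m) : med m = m 1 := by
  have h01 : m 0 ≤ m 1 := hm (by decide)
  have h12 : m 1 ≤ m 2 := hm (by decide)
  simp [med, h01, h12]

lemma gap_eq_of_monotone {m : Fin 3 → ℝ} (hm : Monotone m) (u : ℝ) :
    gap u m = gapAt u (m 0 + m 1 + m 2) (m 0 * m 1 + m 0 * m 2 + m 1 * m 2) (m 1) := by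
  rw [gap, med_eq_of_monotone hm]

lemma perm_three_cases (σ : Equiv.Perm (Fin 3)) :
    (σ 0 = 0 ∧ σ 1 = 1 ∧ σ 2 = 2) ∨ (σ 0 = 0 ∧ σ 1 = 2 ∧ σ 2 = 1) ∨
    (σ 0 = 1 ∧ σ 1 = 0 ∧ σ 2 = 2) ∨ (σ 0 = 1 ∧ σ 1 = 2 ∧ σ 2 = 0) ∨
    (σ 0 = 2 ∧ σ 1 = 0 ∧ σ 2 = 1) ∨ (σ 0 = 2 ∧ σ 1 = 1 ∧ σ 2 = 0) := by
  revert σ; decide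

lemma sum_comp_perm (m : Fin 3 → ℝ) (σ : Equiv.Perm (Fin 3)) :
    (m ∘ σ) 0 + (m ∘ σ) 1 + (m ∘ σ) 2 = m 0 + m 1 + m 2 := by
  rcases perm_three_cases σ with ⟨h0, h1, h2⟩ | ⟨h0, h1, h2⟩ | ⟨h0, h1, h2⟩ | ⟨h0, h1, h2⟩ |
    ⟨h0, h1, h2⟩ | ⟨h0, h1, h2⟩ <;> simp only [Function.comp, h0, h1, h2] <;> ring

lemma med_comp_perm (m : Fin 3 → ℝ) (σ : Equiv.Perm (Fin 3)) : med (m ∘ σ) = med m := by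
  rcases perm_three_cases σ with ⟨h0, h1, h2⟩ | ⟨h0, h1, h2⟩ | ⟨h0, h1, h2⟩ | ⟨h0, h1, h2⟩ |
    ⟨h0, h1, h2⟩ | ⟨h0, h1, h2⟩ <;> simp only [med, Function.comp, h0, h1, h2] <;> grind

lemma gap_comp_perm (u : ℝ) (m : Fin 3 → ℝ) (σ : Equiv.Perm (Fin 3)) :
    gap u (m ∘ σ) = gap u m := by
  unfold gap
  rw [sum_comp_perm, med_comp_perm]
  congr 1
  rcases perm_three_cases σ with ⟨h0, h1, h2⟩ | ⟨h0, h1, h2⟩ | ⟨h0, h1, h2⟩ | ⟨h0, h1, h2⟩ |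
    ⟨h0, h1, h2⟩ | ⟨h0, h1, h2⟩ <;> simp only [Function.comp, h0, h1, h2] <;> ring

lemma exists_perm_monotone (m : Fin 3 → ℝ) : ∃ σ : Equiv.Perm (Fin 3), Monotone (m ∘ σ) :=
  ⟨Tuple.sort m, Tuple.monotone_sort m⟩

lemma gapAt_middle_le {u x₀ x₁ x₂ : ℝ} (h01 : x₀ ≤ x₁) (h12 : x₁ ≤ x₂) (hu : 0 < u)
    (h : 0 ≤ gapAt u (x₀ + x₁ + x₂) (x₀ * x₁ + x₀ * x₂ + x₁ * x₂) x₁) :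
    (3 * u - 1) * x₁ * (x₁ - u * (x₀ + x₁ + x₂)) ≤ 0 := by
  have h1 : 0 ≤ u * ((x₁ - x₀) * (x₂ - x₁)) :=
    mul_nonneg hu.le (mul_nonneg (by linarith) (by linarith))
  unfold gapAt at h
  linarith [show u * (x₀ * x₁ + x₀ * x₂ + x₁ * x₂) +
      (2 - 3 * u) * x₁ * (x₁ - 2 * u * (x₀ + x₁ + x₂)) + u * ((x₁ - x₀) * (x₂ - x₁)) +
      2 * ((3 * u - 1) * x₁ * (x₁ - u * (x₀ + x₁ + x₂))) = 0 by ring]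

/-- On the prolate side `u < 1/3`, triples of nonnegative gap have their middle entry above the
fraction `u` of their sum. -/
lemma mul_sum_le_middle {u x₀ x₁ x₂ : ℝ} (h01 : x₀ ≤ x₁) (h12 : x₁ ≤ x₂) (hu : 0 < u)
    (hu' : u < 1 / 3) (hx : 0 < x₁)
    (h : 0 ≤ gapAt u (x₀ + x₁ + x₂) (x₀ * x₁ + x₀ * x₂ + x₁ * x₂) x₁) :
    u * (x₀ + x₁ + x₂) ≤ x₁ := by
  have := gapAt_middle_le h01 h12 hu h
  by_contra hcon
  push Not at hcon
  have : 0 < (1 - 3 * u) * x₁ * (u * (x₀ + x₁ + x₂) - x₁) :=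
    mul_pos (mul_pos (by linarith) hx) (by linarith)
  linarith

/-- On the oblate side `1/3 < u`, triples of nonnegative gap have their middle entry below the
fraction `u` of their sum. -/
lemma middle_le_mul_sum {u x₀ x₁ x₂ : ℝ} (h01 : x₀ ≤ x₁) (h12 : x₁ ≤ x₂)
    (hu' : 1 / 3 < u) (hx : 0 < x₁)
    (h : 0 ≤ gapAt u (x₀ + x₁ + x₂) (x₀ * x₁ + x₀ * x₂ + x₁ * x₂) x₁) :
    x₁ ≤ u * (x₀ + x₁ + x₂) := by
  have := gapAt_middle_le h01 h12 (by linarith) h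
  by_contra hcon
  push Not at hcon
  have : 0 < (3 * u - 1) * x₁ * (x₁ - u * (x₀ + x₁ + x₂)) :=
    mul_pos (mul_pos (by linarith) hx) (by linarith)
  linarith

/-! ### Orthogonal diagonalization and interlacing -/

/-- The columns of the orthogonal matrix `V` are eigenvectors of `A`, with eigenvalues `f`. -/
def DiagonalizedBy (V A : Matrix (Fin 3) (Fin 3) ℝ) (f : Fin 3 → ℝ) : Prop :=
  Vᵀ * V = 1 ∧ A = V * Matrix.diagonal f * Vᵀ

lemma DiagonalizedBy.perm {V A : Matrix (Fin 3) (Fin 3) ℝ} {f : Fin 3 → ℝ}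
    (h : DiagonalizedBy V A f) (σ : Equiv.Perm (Fin 3)) :
    DiagonalizedBy (V.submatrix id σ) A (f ∘ σ) := by
  refine ⟨?_, ?_⟩
  · have : (V.submatrix id σ)ᵀ * V.submatrix id σ = (Vᵀ * V).submatrix σ σ := by
      ext i j; simp [Matrix.mul_apply]
    rw [this, h.1, Matrix.submatrix_one_equiv]
  · rw [h.2]
    ext i j
    rw [Matrix.mul_apply, Matrix.mul_apply]
    simp only [Matrix.mul_diagonal, Matrix.submatrix_apply, id, Matrix.transpose_apply,
      Function.comp]
    exact (Equiv.sum_comp σ (fun k => V i k * f k * V j k)).symm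

lemma DiagonalizedBy.smul {V A : Matrix (Fin 3) (Fin 3) ℝ} {f : Fin 3 → ℝ}
    (h : DiagonalizedBy V A f) (r : ℝ) : DiagonalizedBy V (r • A) (r • f) := by
  refine ⟨h.1, ?_⟩
  rw [h.2, Matrix.diagonal_smul, Matrix.mul_smul, Matrix.smul_mul]

lemma exists_diagonalizedBy_monotone {A : Matrix (Fin 3) (Fin 3) ℝ} (hA : A.IsSymm) :
    ∃ V m, Monotone m ∧ DiagonalizedBy V A m := by
  have hH : A.IsHermitian := by
    rw [Matrix.IsHermitian, Matrix.conjTranspose_eq_transpose_of_trivial]; exact hA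
  have h : DiagonalizedBy (hH.eigenvectorUnitary : Matrix (Fin 3) (Fin 3) ℝ) A hH.eigenvalues := by
    have hs : star (hH.eigenvectorUnitary : Matrix (Fin 3) (Fin 3) ℝ) =
        (hH.eigenvectorUnitary : Matrix (Fin 3) (Fin 3) ℝ)ᵀ := by
      rw [Matrix.star_eq_conjTranspose, Matrix.conjTranspose_eq_transpose_of_trivial]
    refine ⟨?_, ?_⟩
    · rw [← hs]; exact Unitary.coe_star_mul_self _
    · have := hH.spectral_theorem
      rw [Unitary.conjStarAlgAut_apply, hs] at this
      exact this
  obtain ⟨σ, hσ⟩ := exists_perm_monotone hH.eigenvalues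
  exact ⟨_, _, hσ, h.perm σ⟩

lemma DiagonalizedBy.charpoly {V A : Matrix (Fin 3) (Fin 3) ℝ} {f : Fin 3 → ℝ}
    (h : DiagonalizedBy V A f) :
    A.charpoly = ∏ i, (Polynomial.X - Polynomial.C (f i)) := by
  rw [h.2, Matrix.charpoly_mul_comm, ← mul_assoc, h.1, one_mul, Matrix.charpoly_diagonal]

lemma DiagonalizedBy.det_sub {V A : Matrix (Fin 3) (Fin 3) ℝ} {f : Fin 3 → ℝ}
    (h : DiagonalizedBy V A f) (z : ℝ) :
    (Matrix.scalar (Fin 3) z - A).det = (z - f 0) * (z - f 1) * (z - f 2) := by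
  rw [← Matrix.eval_charpoly, h.charpoly, Polynomial.eval_prod, Fin.prod_univ_three]
  simp

lemma DiagonalizedBy.trace {V A : Matrix (Fin 3) (Fin 3) ℝ} {f : Fin 3 → ℝ}
    (h : DiagonalizedBy V A f) : A.trace = f 0 + f 1 + f 2 := by
  rw [h.2, Matrix.trace_mul_comm, ← mul_assoc, h.1, one_mul, Matrix.trace_diagonal,
    Fin.sum_univ_three]

lemma DiagonalizedBy.quadForm {V A : Matrix (Fin 3) (Fin 3) ℝ} {f : Fin 3 → ℝ}
    (h : DiagonalizedBy V A f) (v : Fin 3 → ℝ) :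
    v ⬝ᵥ A *ᵥ v = ∑ i, f i * (Vᵀ *ᵥ v) i ^ 2 := by
  rw [h.2, ← Matrix.mulVec_mulVec, ← Matrix.mulVec_mulVec, Matrix.dotProduct_mulVec,
    ← Matrix.mulVec_transpose, dotProduct]
  refine Finset.sum_congr rfl fun i _ => ?_
  rw [Matrix.mulVec_diagonal]; ring

lemma DiagonalizedBy.dot_self {V A : Matrix (Fin 3) (Fin 3) ℝ} {f : Fin 3 → ℝ}
    (h : DiagonalizedBy V A f) (v : Fin 3 → ℝ) :
    v ⬝ᵥ v = ∑ i, (Vᵀ *ᵥ v) i ^ 2 := by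
  have h1 : V * Vᵀ = 1 := mul_eq_one_comm.mp h.1
  have : DiagonalizedBy V 1 (fun _ => 1) :=
    ⟨h.1, by rw [Matrix.diagonal_one, mul_one, h1]⟩
  have := this.quadForm v
  simpa using this

/-- A lower bound of the quadratic form by an eigenvalue, off the lower eigenvectors. -/
lemma DiagonalizedBy.le_quadForm {V A : Matrix (Fin 3) (Fin 3) ℝ} {f : Fin 3 → ℝ}
    (h : DiagonalizedBy V A f) {a : ℝ} {v : Fin 3 → ℝ}
    (hv : ∀ i, f i < a → (Vᵀ *ᵥ v) i = 0) : a * (v ⬝ᵥ v) ≤ v ⬝ᵥ A *ᵥ v := by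
  rw [h.quadForm, h.dot_self, Finset.mul_sum]
  refine Finset.sum_le_sum fun i _ => ?_
  rcases lt_or_ge (f i) a with hi | hi
  · simp [hv i hi]
  · exact mul_le_mul_of_nonneg_right hi (sq_nonneg _)

/-- An upper bound of the quadratic form by an eigenvalue, off the higher eigenvectors. -/
lemma DiagonalizedBy.quadForm_le {V A : Matrix (Fin 3) (Fin 3) ℝ} {f : Fin 3 → ℝ}
    (h : DiagonalizedBy V A f) {a : ℝ} {v : Fin 3 → ℝ}
    (hv : ∀ i, a < f i → (Vᵀ *ᵥ v) i = 0) : v ⬝ᵥ A *ᵥ v ≤ a * (v ⬝ᵥ v) := by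
  rw [h.quadForm, h.dot_self, Finset.mul_sum]
  refine Finset.sum_le_sum fun i _ => ?_
  rcases lt_or_ge a (f i) with hi | hi
  · simp [hv i hi]
  · exact mul_le_mul_of_nonneg_right hi (sq_nonneg _)

/-- The dimension count behind the interlacing inequalities. -/
lemma exists_ne_zero_orthogonal (a b : Fin 3 → ℝ) :
    ∃ v : Fin 3 → ℝ, 0 < v ⬝ᵥ v ∧ a ⬝ᵥ v = 0 ∧ b ⬝ᵥ v = 0 := by
  have hk : LinearMap.ker (Matrix.mulVecLin (Matrix.of ![a, b])) ≠ ⊥ :=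
    LinearMap.ker_ne_bot_of_finrank_lt (by simp)
  obtain ⟨v, hv, hv0⟩ := (Submodule.ne_bot_iff _).mp hk
  rw [LinearMap.mem_ker, Matrix.mulVecLin_apply] at hv
  refine ⟨v, ?_, ?_, ?_⟩
  · refine lt_of_le_of_ne (Finset.sum_nonneg fun i _ => mul_self_nonneg _) (Ne.symm ?_)
    rwa [Ne, dotProduct_self_eq_zero]
  · simpa [Matrix.mulVec] using congrFun hv 0
  · simpa [Matrix.mulVec] using congrFun hv 1

lemma mulVec_vecMulVec_quadForm (n v : Fin 3 → ℝ) :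
    v ⬝ᵥ Matrix.vecMulVec n n *ᵥ v = (n ⬝ᵥ v) ^ 2 := by
  rw [Matrix.vecMulVec_mulVec]
  simp only [dotProduct_smul, op_smul_eq_smul, smul_eq_mul]
  rw [dotProduct_comm v n]; ring

lemma monotone_lt_one {f : Fin 3 → ℝ} (hf : Monotone f) {i : Fin 3} (h : f i < f 1) : i = 0 := by
  by_contra hi
  exact absurd (hf (show (1 : Fin 3) ≤ i by omega)) (not_le.mpr h)

lemma monotone_one_lt {f : Fin 3 → ℝ} (hf : Monotone f) {i : Fin 3} (h : f 1 < f i) : i = 2 := by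
  by_contra hi
  exact absurd (hf (show i ≤ (1 : Fin 3) by omega)) (not_le.mpr h)

lemma monotone_not_lt_zero {f : Fin 3 → ℝ} (hf : Monotone f) {i : Fin 3} (h : f i < f 0) :
    False := absurd (hf (Fin.zero_le i)) (not_le.mpr h)

lemma monotone_not_two_lt {f : Fin 3 → ℝ} (hf : Monotone f) {i : Fin 3} (h : f 2 < f i) :
    False := absurd (hf (show i ≤ (2 : Fin 3) by omega)) (not_le.mpr h)

section Interlacing

variable {V W A B : Matrix (Fin 3) (Fin 3) ℝ} {f g n : Fin 3 → ℝ} {c : ℝ}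

lemma quadForm_rankOne_add (hB : B = A + c • Matrix.vecMulVec n n) (v : Fin 3 → ℝ) :
    v ⬝ᵥ B *ᵥ v = v ⬝ᵥ A *ᵥ v + c * (n ⬝ᵥ v) ^ 2 := by
  rw [hB, Matrix.add_mulVec, Matrix.smul_mulVec, dotProduct_add, dotProduct_smul,
    mulVec_vecMulVec_quadForm, smul_eq_mul]

lemma middle_le_of_rankOne_add (hf : Monotone f) (hg : Monotone g) (hA : DiagonalizedBy V A f)
    (hBd : DiagonalizedBy W B g) (hB : B = A + c • Matrix.vecMulVec n n) (hc : 0 ≤ c) :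
    f 1 ≤ g 1 := by
  obtain ⟨v, hv, h1, h2⟩ := exists_ne_zero_orthogonal (fun i => V i 0) (fun i => W i 2)
  have hlo : f 1 * (v ⬝ᵥ v) ≤ v ⬝ᵥ A *ᵥ v := hA.le_quadForm fun i hi => by
    rw [monotone_lt_one hf hi]; exact h1
  have hhi : v ⬝ᵥ B *ᵥ v ≤ g 1 * (v ⬝ᵥ v) := hBd.quadForm_le fun i hi => by
    rw [monotone_one_lt hg hi]; exact h2
  have := quadForm_rankOne_add hB v
  have : 0 ≤ c * (n ⬝ᵥ v) ^ 2 := mul_nonneg hc (sq_nonneg _)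
  exact le_of_mul_le_mul_right (by linarith) hv

lemma low_le_middle_of_rankOne_add (hf : Monotone f) (hg : Monotone g)
    (hA : DiagonalizedBy V A f) (hBd : DiagonalizedBy W B g)
    (hB : B = A + c • Matrix.vecMulVec n n) : g 0 ≤ f 1 := by
  obtain ⟨v, hv, h1, h2⟩ := exists_ne_zero_orthogonal (fun i => V i 2) n
  have hhi : v ⬝ᵥ A *ᵥ v ≤ f 1 * (v ⬝ᵥ v) := hA.quadForm_le fun i hi => by
    rw [monotone_one_lt hf hi]; exact h1
  have hlo : g 0 * (v ⬝ᵥ v) ≤ v ⬝ᵥ B *ᵥ v :=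
    hBd.le_quadForm fun i hi => (monotone_not_lt_zero hg hi).elim
  have := quadForm_rankOne_add hB v
  rw [h2] at this
  exact le_of_mul_le_mul_right (by linarith) hv

lemma middle_le_high_of_rankOne_add (hf : Monotone f) (hg : Monotone g)
    (hA : DiagonalizedBy V A f) (hBd : DiagonalizedBy W B g)
    (hB : B = A + c • Matrix.vecMulVec n n) : g 1 ≤ f 2 := by
  obtain ⟨v, hv, h1, h2⟩ := exists_ne_zero_orthogonal (fun i => W i 0) n
  have hhi : v ⬝ᵥ A *ᵥ v ≤ f 2 * (v ⬝ᵥ v) :=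
    hA.quadForm_le fun i hi => (monotone_not_two_lt hf hi).elim
  have hlo : g 1 * (v ⬝ᵥ v) ≤ v ⬝ᵥ B *ᵥ v := hBd.le_quadForm fun i hi => by
    rw [monotone_lt_one hg hi]; exact h1
  have := quadForm_rankOne_add hB v
  rw [h2] at this
  exact le_of_mul_le_mul_right (by linarith) hv

end Interlacing

/-- Along a rank-one line the characteristic polynomial is affine in the parameter. -/
lemma det_rankOne_pencil (A : Matrix (Fin 3) (Fin 3) ℝ) (n : Fin 3 → ℝ) (c τ z : ℝ) :
    (Matrix.scalar (Fin 3) z - (A + (τ * c) • Matrix.vecMulVec n n)).det =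
      (1 - τ) * (Matrix.scalar (Fin 3) z - A).det +
        τ * (Matrix.scalar (Fin 3) z - (A + c • Matrix.vecMulVec n n)).det := by
  simp only [Matrix.det_fin_three, Matrix.sub_apply, Matrix.add_apply, Matrix.smul_apply,
    Matrix.vecMulVec_apply, Matrix.scalar_apply, Matrix.diagonal_apply, smul_eq_mul]
  simp
  ring

/-! ### Nonnegativity of the gap along rank-one segments -/

section Segment

variable {VA VX VB A X B : Matrix (Fin 3) (Fin 3) ℝ} {f x g n : Fin 3 → ℝ} {c τ u : ℝ}

/-- The gap stays nonnegative along a rank-one segment of positive matrices if it is nonnegative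
at both ends. For `u > 1/3` this is the algebraic statement for `u < 1/3`, applied to the opposite
matrices, for which the segment is run backwards. -/
theorem gap_nonneg_of_rankOne_segment (hf : Monotone f) (hx : Monotone x) (hg : Monotone g)
    (hA : DiagonalizedBy VA A f) (hXd : DiagonalizedBy VX X x) (hBd : DiagonalizedBy VB B g)
    (hX : X = A + (τ * c) • Matrix.vecMulVec n n) (hB : B = A + c • Matrix.vecMulVec n n)
    (hc : 0 ≤ c) (hτ : 0 ≤ τ) (hτ' : τ ≤ 1) (hu : 0 < u) (hu' : u < 1 / 2) (hu3 : u ≠ 1 / 3)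
    (hf0 : ∀ i, 0 < f i) (hg0 : ∀ i, 0 < g i)
    (hF : 0 ≤ gap u f) (hG : 0 ≤ gap u g) : 0 ≤ gap u x := by
  rw [gap_eq_of_monotone hf] at hF
  rw [gap_eq_of_monotone hg] at hG
  rw [gap_eq_of_monotone hx]
  have hf01 : f 0 ≤ f 1 := hf (by decide)
  have hf12 : f 1 ≤ f 2 := hf (by decide)
  have hg01 : g 0 ≤ g 1 := hg (by decide)
  have hg12 : g 1 ≤ g 2 := hg (by decide)
  have hpen : ∀ z, (z - x 0) * (z - x 1) * (z - x 2) =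
      (1 - τ) * ((z - f 0) * (z - f 1) * (z - f 2)) +
        τ * ((z - g 0) * (z - g 1) * (z - g 2)) := by
    intro z
    rw [← hXd.det_sub, ← hA.det_sub, ← hBd.det_sub, hX, hB]
    exact det_rankOne_pencil A n c τ z
  have hfx : f 1 ≤ x 1 := middle_le_of_rankOne_add hf hx hA hXd hX (mul_nonneg hτ hc)
  have hxg : x 1 ≤ g 1 := by
    refine middle_le_of_rankOne_add (c := (1 - τ) * c) (n := n) hx hg hXd hBd ?_
      (mul_nonneg (by linarith) hc)
    rw [hB, hX, add_assoc, ← add_smul]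
    congr 2; ring
  have hx1 : 0 < x 1 := lt_of_lt_of_le (hf0 1) hfx
  rcases lt_or_gt_of_ne hu3 with h3 | h3
  · refine gapAt_nonneg_of_pencil hu hu' hτ hτ' hpen hfx
      (low_le_middle_of_rankOne_add hf hg hA hBd hB) hg12 ?_ hF hG
      (mul_sum_le_middle hf01 hf12 hu h3 (hf0 1) hF)
      (mul_sum_le_middle hg01 hg12 hu h3 (hg0 1) hG)
    exact mul_nonpos_of_nonpos_of_nonneg (by linarith) hx1.le
  · have hF' := middle_le_mul_sum hf01 hf12 h3 (hf0 1) hF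
    have hG' := middle_le_mul_sum hg01 hg12 h3 (hg0 1) hG
    have hneg : ∀ a b c : ℝ, gapAt u (-c + -b + -a) (-c * -b + -c * -a + -b * -a) (-b) =
        gapAt u (a + b + c) (a * b + a * c + b * c) b := by
      intro a b c; unfold gapAt; ring
    rw [← hneg]
    refine gapAt_nonneg_of_pencil (τ := 1 - τ) (f₀ := -g 2) (f₁ := -g 1) (f₂ := -g 0)
      (g₀ := -f 2) (g₁ := -f 1) (g₂ := -f 0) hu hu' (by linarith) (by linarith) ?_
      (by linarith) ?_ (by linarith) ?_ ?_ ?_ (by linarith) (by linarith)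
    · intro z
      linear_combination -hpen (-z)
    · have := middle_le_high_of_rankOne_add hf hg hA hBd hB
      linarith
    · have : 0 ≤ (3 * u - 1) * x 1 := mul_nonneg (by linarith) hx1.le
      linarith
    · rw [hneg]; exact hG
    · rw [hneg]; exact hF

end Segment

/-! ### Stability of the admissible triples -/

/-- The triples of unit sum with entries in `[s₀, s₂]` and nonnegative gaps of parameters `a`
and `b`. -/
def admissibleSet (s : Fin 3 → ℝ) (a b : ℝ) : Set (Fin 3 → ℝ) :=
  {m | m 0 + m 1 + m 2 = 1 ∧ (∀ i, s 0 ≤ m i ∧ m i ≤ s 2) ∧ 0 ≤ gap a m ∧ 0 ≤ gap b m}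

lemma comp_perm_mem_admissibleSet {s m : Fin 3 → ℝ} {a b : ℝ} (h : m ∈ admissibleSet s a b)
    (σ : Equiv.Perm (Fin 3)) : m ∘ σ ∈ admissibleSet s a b := by
  obtain ⟨h1, h2, h3, h4⟩ := h
  refine ⟨by rw [sum_comp_perm, h1], fun i => h2 (σ i), ?_, ?_⟩ <;> rwa [gap_comp_perm]

lemma monotone_smul_of_nonneg {m : Fin 3 → ℝ} (hm : Monotone m) {r : ℝ} (hr : 0 ≤ r) :
    Monotone (r • m) := fun i j hij => by
  simpa using mul_le_mul_of_nonneg_left (hm hij) hr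

lemma gap_smul_of_monotone {m : Fin 3 → ℝ} (hm : Monotone m) {r : ℝ} (hr : 0 ≤ r) (u : ℝ) :
    gap u (r • m) = r ^ 2 * gap u m := by
  rw [gap_eq_of_monotone hm, gap_eq_of_monotone (monotone_smul_of_nonneg hm hr)]
  simp only [gapAt, Pi.smul_apply, smul_eq_mul]; ring

section Segment

variable {VA VB A B : Matrix (Fin 3) (Fin 3) ℝ} {s f g n : Fin 3 → ℝ} {a b μ η : ℝ}

lemma exists_mem_admissibleSet_of_monotone (hf : Monotone f) (hg : Monotone g)
    (hA : DiagonalizedBy VA A f) (hBd : DiagonalizedBy VB B g)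
    (hfL : f ∈ admissibleSet s a b) (hgL : g ∈ admissibleSet s a b) (hs : 0 < s 0)
    (ha : 0 < a) (ha' : a < 1 / 3) (hb : 1 / 3 < b) (hb' : b < 1 / 2)
    (hn : n ⬝ᵥ n = 1) (hμ : 0 < μ) (hμ' : μ < 1) (hη : μ ≤ η) (hη' : η ≤ 1)
    (hB : B = μ • A + (1 - μ) • Matrix.vecMulVec n n) :
    ∃ m ∈ admissibleSet s a b,
      IsOrderedEigenvalues (η • A + (1 - η) • Matrix.vecMulVec n n) m := by
  set M := η • A + (1 - η) • Matrix.vecMulVec n n with hM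
  have hη0 : 0 < η := by linarith
  have hAs : A.IsSymm := by
    rw [Matrix.IsSymm, hA.2]
    simp [Matrix.transpose_mul, mul_assoc]
  have hNs : (Matrix.vecMulVec n n).IsSymm := by
    rw [Matrix.IsSymm, Matrix.transpose_vecMulVec]
  have hMs : M.IsSymm := (hAs.smul η).add (hNs.smul (1 - η))
  obtain ⟨W, m, hm, hMd⟩ := exists_diagonalizedBy_monotone hMs
  have hmA : ∀ i, 0 < f i := fun i => lt_of_lt_of_le hs (hfL.2.1 i).1
  have hmB : ∀ i, 0 < g i := fun i => lt_of_lt_of_le hs (hgL.2.1 i).1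
  refine ⟨m, ⟨?_, ?_, ?_⟩, hm, hMd.charpoly⟩
  · rw [← hMd.trace, hM, Matrix.trace_add, Matrix.trace_smul, Matrix.trace_smul, hA.trace,
      hfL.1, Matrix.trace_vecMulVec, hn]
    simp
  · have hconv : ∀ v : Fin 3 → ℝ, (1 - μ) * (v ⬝ᵥ M *ᵥ v) =
        (η - μ) * (v ⬝ᵥ A *ᵥ v) + (1 - η) * (v ⬝ᵥ B *ᵥ v) := by
      intro v
      rw [hM, hB]
      simp only [Matrix.add_mulVec, Matrix.smul_mulVec, dotProduct_add, dotProduct_smul,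
        smul_eq_mul]
      ring
    have hμ1 : 0 < 1 - μ := by linarith
    have hlow : s 0 ≤ m 0 := by
      obtain ⟨v, hv, h1, h2⟩ := exists_ne_zero_orthogonal (fun i => W i 1) (fun i => W i 2)
      have e1 : v ⬝ᵥ M *ᵥ v ≤ m 0 * (v ⬝ᵥ v) := hMd.quadForm_le fun i hi => by
        fin_cases i
        · exact absurd hi (lt_irrefl _)
        · exact h1
        · exact h2
      have e2 : s 0 * (v ⬝ᵥ v) ≤ v ⬝ᵥ A *ᵥ v :=
        hA.le_quadForm fun i hi => absurd (hfL.2.1 i).1 (not_le.mpr hi)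
      have e3 : s 0 * (v ⬝ᵥ v) ≤ v ⬝ᵥ B *ᵥ v :=
        hBd.le_quadForm fun i hi => absurd (hgL.2.1 i).1 (not_le.mpr hi)
      have e4 := mul_le_mul_of_nonneg_left e2 (show 0 ≤ η - μ by linarith)
      have e5 := mul_le_mul_of_nonneg_left e3 (show 0 ≤ 1 - η by linarith)
      have e6 := mul_le_mul_of_nonneg_left e1 hμ1.le
      have e7 : (1 - μ) * (s 0 * (v ⬝ᵥ v)) ≤ (1 - μ) * (m 0 * (v ⬝ᵥ v)) := by
        linarith [hconv v]
      exact le_of_mul_le_mul_right (le_of_mul_le_mul_left e7 hμ1) hv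
    have hhigh : m 2 ≤ s 2 := by
      obtain ⟨v, hv, h1, h2⟩ := exists_ne_zero_orthogonal (fun i => W i 0) (fun i => W i 1)
      have e1 : m 2 * (v ⬝ᵥ v) ≤ v ⬝ᵥ M *ᵥ v := hMd.le_quadForm fun i hi => by
        fin_cases i
        · exact h1
        · exact h2
        · exact absurd hi (lt_irrefl _)
      have e2 : v ⬝ᵥ A *ᵥ v ≤ s 2 * (v ⬝ᵥ v) :=
        hA.quadForm_le fun i hi => absurd (hfL.2.1 i).2 (not_le.mpr hi)
      have e3 : v ⬝ᵥ B *ᵥ v ≤ s 2 * (v ⬝ᵥ v) :=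
        hBd.quadForm_le fun i hi => absurd (hgL.2.1 i).2 (not_le.mpr hi)
      have e4 := mul_le_mul_of_nonneg_left e2 (show 0 ≤ η - μ by linarith)
      have e5 := mul_le_mul_of_nonneg_left e3 (show 0 ≤ 1 - η by linarith)
      have e6 := mul_le_mul_of_nonneg_left e1 hμ1.le
      have e7 : (1 - μ) * (m 2 * (v ⬝ᵥ v)) ≤ (1 - μ) * (s 2 * (v ⬝ᵥ v)) := by
        linarith [hconv v]
      exact le_of_mul_le_mul_right (le_of_mul_le_mul_left e7 hμ1) hv
    exact fun i => ⟨hlow.trans (hm (Fin.zero_le i)),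
      (hm (show i ≤ (2 : Fin 3) by omega)).trans hhigh⟩
  · -- undo the normalization of the trace: the matrices `A`, `η⁻¹ M` and `μ⁻¹ B` lie on a
    -- rank-one segment
    have key : ∀ u, 0 < u → u < 1 / 2 → u ≠ 1 / 3 → 0 ≤ gap u f → 0 ≤ gap u g →
        0 ≤ gap u m := by
      intro u h1 h2 h3 hF hG
      have hη1 : 0 < η⁻¹ := inv_pos.mpr hη0
      have hμ1 : 0 < μ⁻¹ := inv_pos.mpr hμ
      have hGs : 0 ≤ gap u (μ⁻¹ • g) := by
        rw [gap_smul_of_monotone hg hμ1.le]; positivity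
      have hcoef : (1 - η) / η = (1 - η) * μ / (η * (1 - μ)) * ((1 - μ) / μ) := by
        have : 1 - μ ≠ 0 := by linarith
        field_simp
      have hX : η⁻¹ • M = A + ((1 - η) * μ / (η * (1 - μ)) * ((1 - μ) / μ)) •
          Matrix.vecMulVec n n := by
        rw [← hcoef, hM, smul_add, smul_smul, smul_smul, inv_mul_cancel₀ hη0.ne', one_smul,
          div_eq_inv_mul]
      have hB' : μ⁻¹ • B = A + ((1 - μ) / μ) • Matrix.vecMulVec n n := by
        rw [hB, smul_add, smul_smul, smul_smul, inv_mul_cancel₀ hμ.ne', one_smul,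
          div_eq_inv_mul]
      have hτ' : (1 - η) * μ / (η * (1 - μ)) ≤ 1 := by
        rw [div_le_one (mul_pos hη0 (by linarith))]
        linarith
      have := gap_nonneg_of_rankOne_segment hf (monotone_smul_of_nonneg hm hη1.le)
        (monotone_smul_of_nonneg hg hμ1.le) hA (hMd.smul η⁻¹) (hBd.smul μ⁻¹) hX hB'
        (div_nonneg (by linarith) hμ.le)
        (div_nonneg (mul_nonneg (by linarith) hμ.le) (mul_nonneg hη0.le (by linarith)))
        hτ' h1 h2 h3 hmA (fun i => by simpa using mul_pos hμ1 (hmB i)) hF hGs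
      rw [gap_smul_of_monotone hm hη1.le] at this
      exact nonneg_of_mul_nonneg_right this (by positivity)
    exact ⟨key a ha (by linarith) ha'.ne hfL.2.2.1 hgL.2.2.1,
      key b (by linarith) hb' hb.ne' hfL.2.2.2 hgL.2.2.2⟩

/-- The rank-one segment between two matrices with admissible eigenvalues has, after
normalization of the trace, admissible eigenvalues. -/
theorem exists_mem_admissibleSet (hA : DiagonalizedBy VA A f) (hBd : DiagonalizedBy VB B g)
    (hfL : f ∈ admissibleSet s a b) (hgL : g ∈ admissibleSet s a b) (hs : 0 < s 0)
    (ha : 0 < a) (ha' : a < 1 / 3) (hb : 1 / 3 < b) (hb' : b < 1 / 2)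
    (hn : n ⬝ᵥ n = 1) (hμ : 0 < μ) (hμ' : μ < 1) (hη : μ ≤ η) (hη' : η ≤ 1)
    (hB : B = μ • A + (1 - μ) • Matrix.vecMulVec n n) :
    ∃ m ∈ admissibleSet s a b,
      IsOrderedEigenvalues (η • A + (1 - η) • Matrix.vecMulVec n n) m := by
  obtain ⟨σ, hσ⟩ := exists_perm_monotone f
  obtain ⟨ρ, hρ⟩ := exists_perm_monotone g
  exact exists_mem_admissibleSet_of_monotone hσ hρ (hA.perm σ) (hBd.perm ρ)
    (comp_perm_mem_admissibleSet hfL σ) (comp_perm_mem_admissibleSet hgL ρ) hs ha ha' hb hb'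
    hn hμ hμ' hη hη' hB

end Segment

lemma exists_unit_of_rank_one {C : Matrix (Fin 3) (Fin 3) ℝ} (hC : C.IsSymm) (hr : C.rank = 1) :
    ∃ n : Fin 3 → ℝ, n ⬝ᵥ n = 1 ∧ C.trace ≠ 0 ∧ C = C.trace • Matrix.vecMulVec n n := by
  obtain ⟨V, m, -, hV⟩ := exists_diagonalizedBy_monotone hC
  have h1 : V * Vᵀ = 1 := mul_eq_one_comm.mp hV.1
  have hdet : IsUnit V.det := Matrix.isUnit_det_of_right_inverse h1
  have hdet' : IsUnit Vᵀ.det := Matrix.isUnit_det_of_right_inverse hV.1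
  have hcard : Fintype.card {i // m i ≠ 0} = 1 := by
    rw [← Matrix.rank_diagonal, ← hr, hV.2, Matrix.rank_mul_eq_left_of_isUnit_det _ _ hdet',
      Matrix.rank_mul_eq_right_of_isUnit_det _ _ hdet]
  obtain ⟨⟨i, hi⟩, huniq⟩ := Fintype.card_eq_one_iff.mp hcard
  have hz : ∀ k, k ≠ i → m k = 0 := by
    intro k hk
    by_contra hne
    exact hk (congrArg Subtype.val (huniq ⟨k, hne⟩))
  have htr : C.trace = m i := by
    rw [hV.trace, ← Fin.sum_univ_three, Finset.sum_eq_single i (fun k _ hk => hz k hk) (by simp)]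
  refine ⟨fun a => V a i, ?_, by rwa [htr], ?_⟩
  · have := congrFun (congrFun hV.1 i) i
    rwa [Matrix.one_apply_eq] at this
  · rw [htr]
    ext a b
    conv_lhs => rw [hV.2, Matrix.mul_apply]
    simp only [Matrix.mul_diagonal, Matrix.transpose_apply, Matrix.smul_apply,
      Matrix.vecMulVec_apply, smul_eq_mul]
    rw [Finset.sum_eq_single i (fun k _ hk => by rw [hz k hk]; ring) (by simp)]
    ring

lemma eta_mem_of_lt_one {lam t : ℝ} (h0 : 0 < lam) (h1 : lam ≤ 1) (ht : t ∈ Set.Icc (0 : ℝ) 1) :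
    lam ≤ eta lam t ∧ eta lam t ≤ 1 := by
  obtain ⟨ht0, ht1⟩ := ht
  have hp : 0 ≤ t * (1 - lam) := mul_nonneg ht0 (by linarith)
  have hp' : t * (1 - lam) ≤ 1 * (1 - lam) := mul_le_mul_of_nonneg_right ht1 (by linarith)
  have hd : 0 < lam + t * (1 - lam) := by linarith
  unfold eta
  rw [le_div_iff₀ hd, div_le_one hd]
  refine ⟨?_, by linarith⟩
  have : lam * (lam + t * (1 - lam)) ≤ lam * 1 := mul_le_mul_of_nonneg_left (by linarith) h0.le
  linarith

lemma eta_mem_of_one_lt {lam t : ℝ} (h1 : 1 ≤ lam) (ht : t ∈ Set.Icc (0 : ℝ) 1) :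
    1 ≤ eta lam t ∧ eta lam t ≤ lam := by
  obtain ⟨ht0, ht1⟩ := ht
  have hp : 0 ≤ t * (lam - 1) := mul_nonneg ht0 (by linarith)
  have hp' : t * (lam - 1) ≤ 1 * (lam - 1) := mul_le_mul_of_nonneg_right ht1 (by linarith)
  have hd : 0 < lam + t * (1 - lam) := by linarith
  unfold eta
  rw [le_div_iff₀ hd, div_le_iff₀ hd]
  refine ⟨by linarith, ?_⟩
  have : lam * 1 ≤ lam * (lam + t * (1 - lam)) := mul_le_mul_of_nonneg_left (by linarith)
    (by linarith)
  linarith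

theorem stableUnderLamination_admissibleSet {s : Fin 3 → ℝ} {a b : ℝ} (hs : 0 < s 0)
    (ha : 0 < a) (ha' : a < 1 / 3) (hb : 1 / 3 < b) (hb' : b < 1 / 2) :
    StableUnderLamination (admissibleSet s a b) := by
  intro f hf g hg lam R hR hrank
  rw [Matrix.mem_specialOrthogonalGroup_iff, Matrix.mem_orthogonalGroup_iff] at hR
  have hRR : R * Rᵀ = 1 := hR.1
  have hA : DiagonalizedBy 1 (Matrix.diagonal f) f := ⟨by simp, by simp⟩
  have hB : DiagonalizedBy Rᵀ (Rᵀ * Matrix.diagonal g * R) g := by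
    refine ⟨?_, ?_⟩ <;> rw [Matrix.transpose_transpose]
    exact hRR
  set B := Rᵀ * Matrix.diagonal g * R with hBdef
  have hsymm : (lam • Matrix.diagonal f - B).IsSymm := by
    rw [Matrix.IsSymm, hBdef]
    simp [Matrix.transpose_mul, mul_assoc]
  obtain ⟨n, hn, htr0, hC⟩ := exists_unit_of_rank_one hsymm hrank
  have htr : (lam • Matrix.diagonal f - B).trace = lam - 1 := by
    rw [Matrix.trace_sub, Matrix.trace_smul, hA.trace, hB.trace, hf.1, hg.1]
    simp
  rw [htr] at hC htr0
  have hBn : B = lam • Matrix.diagonal f + (1 - lam) • Matrix.vecMulVec n n := by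
    rw [show (1 - lam) = -(lam - 1) by ring, neg_smul, ← hC]; abel
  -- on the plane orthogonal to `n` the positive forms of `B` and `lam F` agree
  have hlam : 0 < lam := by
    obtain ⟨v, hv, h1, -⟩ := exists_ne_zero_orthogonal n n
    have e1 : s 0 * (v ⬝ᵥ v) ≤ v ⬝ᵥ Matrix.diagonal f *ᵥ v :=
      hA.le_quadForm fun i hi => absurd (hf.2.1 i).1 (not_le.mpr hi)
    have e2 : s 0 * (v ⬝ᵥ v) ≤ v ⬝ᵥ B *ᵥ v :=
      hB.le_quadForm fun i hi => absurd (hg.2.1 i).1 (not_le.mpr hi)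
    have e3 := quadForm_rankOne_add hBn v
    rw [h1, Matrix.smul_mulVec, dotProduct_smul, smul_eq_mul] at e3
    have e4 : 0 < s 0 * (v ⬝ᵥ v) := mul_pos hs hv
    have e5 : 0 < lam * (v ⬝ᵥ Matrix.diagonal f *ᵥ v) := by linarith
    exact pos_of_mul_pos_left e5 (by linarith)
  refine ⟨n, hn, hBn, fun t ht => ?_⟩
  rcases lt_or_gt_of_ne (show lam ≠ 1 by intro h; exact htr0 (by linarith)) with h1 | h1
  · obtain ⟨e1, e2⟩ := eta_mem_of_lt_one hlam h1.le ht
    exact exists_mem_admissibleSet hA hB hf hg hs ha ha' hb hb' hn hlam h1 e1 e2 hBn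
  · -- for `lam > 1` the segment runs from `G` to `F`, with `lam⁻¹` in place of `lam`
    obtain ⟨e1, e2⟩ := eta_mem_of_one_lt h1.le ht
    have hinv : Matrix.diagonal f = lam⁻¹ • B + (1 - lam⁻¹) • Matrix.vecMulVec n n := by
      rw [hBn, smul_add, smul_smul, smul_smul, inv_mul_cancel₀ hlam.ne', one_smul, add_assoc,
        ← add_smul, show lam⁻¹ * (1 - lam) + (1 - lam⁻¹) = 0 by field_simp; ring, zero_smul,
        add_zero]
    obtain ⟨m, hm, hM⟩ := exists_mem_admissibleSet (η := eta lam t / lam) hB hA hg hf hs ha ha'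
      hb hb' hn (inv_pos.mpr hlam) (inv_lt_one_of_one_lt₀ h1)
      (by rw [le_div_iff₀ hlam, inv_mul_cancel₀ hlam.ne']; exact e1)
      (by rw [div_le_one hlam]; exact e2) hinv
    refine ⟨m, hm, ?_⟩
    have : rankOneCurve f n lam t = (eta lam t / lam) • B +
        (1 - eta lam t / lam) • Matrix.vecMulVec n n := by
      rw [rankOneCurve, hBn, smul_add, smul_smul, smul_smul, add_assoc, ← add_smul,
        div_mul_cancel₀ _ hlam.ne']
      congr 2
      field_simp; ring
    rw [this]; exact hM

/-! ### The hexagon -/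

/-- A convex set that is stable under permutations is stable under moving two entries of a triple
towards each other with their sum fixed. -/
lemma transfer_mem {C : Set (Fin 3 → ℝ)} (hC : Convex ℝ C)
    (hperm : ∀ p ∈ C, ∀ σ : Equiv.Perm (Fin 3), p ∘ σ ∈ C) {p q : Fin 3 → ℝ} (hp : p ∈ C)
    {i j : Fin 3} (hoff : ∀ k, k ≠ i → k ≠ j → q k = p k) (hij : q i + q j = p i + p j)
    (hi : p i ≤ q i) (hj : q i ≤ p j) : q ∈ C := by
  set w := (q i - p i) / (p j - p i) with hw
  have hd : 0 ≤ p j - p i := by linarith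
  have hw0 : 0 ≤ w := div_nonneg (by linarith) hd
  have hw1 : w ≤ 1 := div_le_one_of_le₀ (by linarith) hd
  have hwm : w * (p j - p i) = q i - p i := by
    rcases hd.eq_or_lt with h | h
    · rw [← h]; linarith
    · rw [hw, div_mul_cancel₀ _ h.ne']
  have hmem := hC hp (hperm p hp (Equiv.swap i j)) (show 0 ≤ 1 - w by linarith) hw0 (by ring)
  convert hmem using 1
  funext k
  simp only [Pi.add_apply, Pi.smul_apply, smul_eq_mul, Function.comp]
  by_cases hki : k = i
  · subst hki
    rw [Equiv.swap_apply_left]; linarith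
  · by_cases hkj : k = j
    · subst hkj
      rw [Equiv.swap_apply_right]; linarith
    · rw [Equiv.swap_apply_of_ne_of_ne hki hkj, hoff k hki hkj]; ring

lemma comp_perm_mem_hexagon {s m : Fin 3 → ℝ} (h : m ∈ hexagon s) (σ : Equiv.Perm (Fin 3)) :
    m ∘ σ ∈ hexagon s := by
  have hsub : hexagon s ⊆ (LinearMap.funLeft ℝ ℝ σ) ⁻¹' hexagon s := by
    refine convexHull_min ?_ ((convex_convexHull ℝ _).linear_preimage _)
    rintro _ ⟨τ, rfl⟩
    exact subset_convexHull ℝ _ ⟨τ * σ, rfl⟩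
  exact hsub h

/-- The hexagon consists of the triples of unit sum whose entries lie between the extreme entries
of `s`. -/
theorem mem_hexagon_iff {s : Fin 3 → ℝ} (h01 : s 0 ≤ s 1) (h12 : s 1 ≤ s 2)
    (hsum : s 0 + s 1 + s 2 = 1) {m : Fin 3 → ℝ} :
    m ∈ hexagon s ↔ m 0 + m 1 + m 2 = 1 ∧ ∀ i, s 0 ≤ m i ∧ m i ≤ s 2 := by
  constructor
  · have hconv : Convex ℝ {m : Fin 3 → ℝ | m 0 + m 1 + m 2 = 1 ∧ ∀ i, s 0 ≤ m i ∧ m i ≤ s 2} := by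
      rintro p ⟨hp, hp'⟩ q ⟨hq, hq'⟩ a b ha hb hab
      refine ⟨?_, fun i => ⟨?_, ?_⟩⟩ <;> simp only [Pi.add_apply, Pi.smul_apply, smul_eq_mul]
      · linear_combination a * hp + b * hq + hab
      · linarith [mul_le_mul_of_nonneg_left (hp' i).1 ha, mul_le_mul_of_nonneg_left (hq' i).1 hb,
          show a * s 0 + b * s 0 = s 0 by rw [← add_mul, hab, one_mul]]
      · linarith [mul_le_mul_of_nonneg_left (hp' i).2 ha, mul_le_mul_of_nonneg_left (hq' i).2 hb,
          show a * s 2 + b * s 2 = s 2 by rw [← add_mul, hab, one_mul]]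
    refine fun h => convexHull_min ?_ hconv h
    rintro _ ⟨σ, rfl⟩
    refine ⟨by rw [sum_comp_perm, hsum], fun i => ?_⟩
    have : ∀ k : Fin 3, s 0 ≤ s k ∧ s k ≤ s 2 := by
      intro k
      fin_cases k
      · exact ⟨le_rfl, h01.trans h12⟩
      · exact ⟨h01, h12⟩
      · exact ⟨h01.trans h12, le_rfl⟩
    exact this (σ i)
  · rintro ⟨hm, hb⟩
    have hC : Convex ℝ (hexagon s) := convex_convexHull ℝ _
    have hperm : ∀ p ∈ hexagon s, ∀ σ : Equiv.Perm (Fin 3), p ∘ σ ∈ hexagon s :=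
      fun p hp σ => comp_perm_mem_hexagon hp σ
    have hsmem : s ∈ hexagon s := subset_convexHull ℝ _ ⟨1, rfl⟩
    suffices key : ∀ p : Fin 3 → ℝ, Monotone p → p 0 + p 1 + p 2 = 1 →
        (∀ i, s 0 ≤ p i ∧ p i ≤ s 2) → p ∈ hexagon s by
      obtain ⟨σ, hσ⟩ := exists_perm_monotone m
      have := hperm _ (key (m ∘ σ) hσ (by rw [sum_comp_perm, hm]) fun i => hb (σ i)) σ⁻¹
      rwa [Function.comp_assoc, show ((σ : Fin 3 → Fin 3) ∘ ((σ⁻¹ : Equiv.Perm (Fin 3)) :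
        Fin 3 → Fin 3)) = id by funext k; simp, Function.comp_id] at this
    intro p hp hp1 hpb
    have hp01 : p 0 ≤ p 1 := hp (by decide)
    have hp12 : p 1 ≤ p 2 := hp (by decide)
    have hb0 := hpb 0
    have hb2 := hpb 2
    -- spread the extreme entries of `p` apart until one of them reaches its bound
    rcases le_total (p 0 - s 0) (s 2 - p 2) with h | h
    · have hq : ![s 0, p 1, p 2 + (p 0 - s 0)] ∈ hexagon s := by
        refine transfer_mem hC hperm hsmem (i := 1) (j := 2) ?_ ?_ ?_ ?_
        · intro k h1 h2; fin_cases k <;> simp_all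
        · simp; linarith
        · simp; linarith
        · simp; linarith
      refine transfer_mem hC hperm hq (i := 0) (j := 2) ?_ ?_ ?_ ?_
      · intro k h1 h2; fin_cases k <;> simp_all
      · simp; ring
      · simp; linarith
      · simp; linarith
    · have hq : ![p 0 - (s 2 - p 2), p 1, s 2] ∈ hexagon s := by
        refine transfer_mem hC hperm hsmem (i := 0) (j := 1) ?_ ?_ ?_ ?_
        · intro k h1 h2; fin_cases k <;> simp_all
        · simp; linarith
        · simp; linarith
        · simp; linarith
      refine transfer_mem hC hperm hq (i := 0) (j := 2) ?_ ?_ ?_ ?_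
      · intro k h1 h2; fin_cases k <;> simp_all
      · simp; ring
      · simp; linarith
      · simp; linarith

/-! ### The parameters of the uniaxial endpoints -/

section Roots

variable {s : Fin 3 → ℝ}

/-- `quadB s` changes sign twice between `0` and `1/2`, namely on both sides of `1/3`. -/
theorem uAlpha_uBeta_spec (h_pos : 0 < s 0) (h_lt : s 0 < s 1) (h_lt' : s 1 < s 2)
    (h_sum : s 0 + s 1 + s 2 = 1) :
    0 < uAlpha s ∧ uAlpha s < 1 / 3 ∧ 1 / 3 < uBeta s ∧ uBeta s < 1 / 2 ∧
      ∀ x, quadB s x = 6 * s 1 * ((x - uAlpha s) * (x - uBeta s)) := by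
  have hcont : Continuous (quadB s) := by unfold quadB; fun_prop
  have h0 : 0 < quadB s 0 := by
    have : 0 < s 1 ^ 2 := by apply pow_pos; linarith
    unfold quadB; linarith
  have h3 : quadB s (1 / 3) < 0 := by
    have e : quadB s (1 / 3) = -((s 1 - s 0) * (s 2 - s 1)) / 3 := by
      unfold quadB; linear_combination (1 / 3) * s 1 * h_sum
    have : 0 < (s 1 - s 0) * (s 2 - s 1) := mul_pos (by linarith) (by linarith)
    rw [e]; linarith
  have h2 : 0 < quadB s (1 / 2) := by
    have e : quadB s (1 / 2) = s 0 * s 2 / 2 := by unfold quadB; ring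
    have : 0 < s 0 * s 2 := mul_pos h_pos (by linarith)
    rw [e]; linarith
  obtain ⟨a, ha, hqa⟩ := intermediate_value_Ioo' (by norm_num : (0 : ℝ) ≤ 1 / 3)
    hcont.continuousOn ⟨h3, h0⟩
  obtain ⟨b, hb, hqb⟩ := intermediate_value_Ioo (by norm_num : (1 / 3 : ℝ) ≤ 1 / 2)
    hcont.continuousOn ⟨h3, h2⟩
  have hab : a < b := ha.2.trans hb.1
  have hs1 : 0 < s 1 := by linarith
  have hfac : ∀ x, quadB s x = 6 * s 1 * ((x - a) * (x - b)) := by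
    intro x
    have e : (b - a) * (quadB s x - 6 * s 1 * ((x - a) * (x - b))) =
        (x - a) * quadB s b - (x - b) * quadB s a := by unfold quadB; ring
    rw [hqa, hqb] at e
    have : quadB s x - 6 * s 1 * ((x - a) * (x - b)) = 0 :=
      (mul_eq_zero.mp (by linarith : (b - a) * _ = 0)).resolve_left (by linarith)
    linarith
  have hset : {x | quadB s x = 0} = {a, b} := by
    ext x
    simp only [Set.mem_ofPred_eq, Set.mem_insert_iff, Set.mem_singleton_iff, hfac, mul_eq_zero,
      sub_eq_zero, OfNat.ofNat_ne_zero, hs1.ne', false_or]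
  have hα : uAlpha s = a := by rw [uAlpha, hset, csInf_pair, min_eq_left hab.le]
  have hβ : uBeta s = b := by rw [uBeta, hset, csSup_pair, max_eq_right hab.le]
  rw [hα, hβ]
  exact ⟨ha.1, ha.2, hb.1, hb.2, hfac⟩

lemma mem_Ioo_of_quadB_neg (h_pos : 0 < s 0) (h_lt : s 0 < s 1) (h_lt' : s 1 < s 2)
    (h_sum : s 0 + s 1 + s 2 = 1) {x : ℝ} (hx : quadB s x < 0) :
    uAlpha s < x ∧ x < uBeta s := by
  obtain ⟨-, h1, h2, -, hfac⟩ := uAlpha_uBeta_spec h_pos h_lt h_lt' h_sum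
  rw [hfac] at hx
  have hx' : (x - uAlpha s) * (x - uBeta s) < 0 := by
    by_contra hcon
    push Not at hcon
    have : 0 ≤ 6 * s 1 * ((x - uAlpha s) * (x - uBeta s)) := mul_nonneg (by linarith) hcon
    linarith
  rcases mul_neg_iff.mp hx' with h | h <;> constructor <;> linarith

lemma quadB_neg_middle (h_lt : s 0 < s 1) (h_lt' : s 1 < s 2) (h_pos : 0 < s 0)
    (h_sum : s 0 + s 1 + s 2 = 1) : quadB s (s 1) < 0 := by
  have e : quadB s (s 1) = -(s 1 * ((s 1 - s 0) * (s 2 - s 1))) := by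
    unfold quadB; linear_combination (s 1 ^ 2) * h_sum
  have : 0 < s 1 * ((s 1 - s 0) * (s 2 - s 1)) :=
    mul_pos (by linarith) (mul_pos (by linarith) (by linarith))
  rw [e]; linarith

/-- This sign makes the squares of `connectionNormal` nonnegative on the prolate side. -/
lemma quadB_neg_low (h_lt : s 0 < s 1) (h_lt' : s 1 < s 2) (h_pos : 0 < s 0)
    (h_sum : s 0 + s 1 + s 2 = 1) : quadB s ((s 0 + 2 * s 1) / 3) < 0 := by
  have e : quadB s ((s 0 + 2 * s 1) / 3) = -(s 0 * ((s 1 - s 0) * (s 2 - s 1))) / 3 := by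
    have : s 2 = 1 - s 0 - s 1 := by linarith
    unfold quadB; rw [this]; ring
  have : 0 < s 0 * ((s 1 - s 0) * (s 2 - s 1)) :=
    mul_pos (by linarith) (mul_pos (by linarith) (by linarith))
  rw [e]; linarith

/-- This sign makes the squares of `connectionNormal` nonnegative on the oblate side. -/
lemma quadB_neg_high (h_lt : s 0 < s 1) (h_lt' : s 1 < s 2) (h_pos : 0 < s 0)
    (h_sum : s 0 + s 1 + s 2 = 1) : quadB s ((s 2 + 2 * s 1) / 3) < 0 := by
  have e : quadB s ((s 2 + 2 * s 1) / 3) = -(s 2 * ((s 1 - s 0) * (s 2 - s 1))) / 3 := by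
    have : s 0 = 1 - s 2 - s 1 := by linarith
    unfold quadB; rw [this]; ring
  have : 0 < s 2 * ((s 1 - s 0) * (s 2 - s 1)) :=
    mul_pos (by linarith) (mul_pos (by linarith) (by linarith))
  rw [e]; linarith

end Roots

/-! ### The rank-one arcs -/

lemma isOrderedEigenvalues_iff {M : Matrix (Fin 3) (Fin 3) ℝ} {m : Fin 3 → ℝ} :
    IsOrderedEigenvalues M m ↔ Monotone m ∧
      ∀ z, (Matrix.scalar (Fin 3) z - M).det = (z - m 0) * (z - m 1) * (z - m 2) := by
  have hev : ∀ z, (∏ i, (Polynomial.X - Polynomial.C (m i))).eval z =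
      (z - m 0) * (z - m 1) * (z - m 2) := by
    intro z
    rw [Polynomial.eval_prod, Fin.prod_univ_three]; simp
  refine and_congr_right fun _ => ⟨fun h z => ?_, fun h => Polynomial.funext fun z => ?_⟩
  · rw [← Matrix.eval_charpoly, h, hev]
  · rw [Matrix.eval_charpoly, hev, h]

lemma det_rankOneCurve_of_middle_zero {s n : Fin 3 → ℝ} (hn : n 1 = 0) (η z : ℝ) :
    (Matrix.scalar (Fin 3) z -
      (η • Matrix.diagonal s + (1 - η) • Matrix.vecMulVec n n)).det =
    (z - η * s 1) * ((z - η * s 0) * (z - η * s 2) -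
      (1 - η) * (n 0 ^ 2 * (z - η * s 2) + n 2 ^ 2 * (z - η * s 0))) := by
  simp only [Matrix.det_fin_three, Matrix.sub_apply, Matrix.add_apply, Matrix.smul_apply,
    Matrix.vecMulVec_apply, Matrix.scalar_apply, Matrix.diagonal_apply, smul_eq_mul, hn]
  simp
  ring

section Arc

variable {s g : Fin 3 → ℝ} {u : ℝ}

lemma connectionNormal_one (hs1 : s 1 ≠ 0)
    (hg : ∀ z, ∏ j, (g j - z) = (u - z) ^ 2 * (1 - 2 * u - z)) :
    connectionNormal s g (u / s 1) 1 = 0 := by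
  rw [connectionNormal, hg, div_mul_cancel₀ _ hs1]
  simp

lemma connectionNormal_zero_sq (hs1 : s 1 ≠ 0) (h01 : s 0 < s 1) (h12 : s 1 < s 2) (hu : u ≠ 0)
    (hg : ∀ z, ∏ j, (g j - z) = (u - z) ^ 2 * (1 - 2 * u - z))
    (hsgn : 0 ≤ (1 - 2 * u - u / s 1 * s 0) / (1 - u / s 1)) :
    connectionNormal s g (u / s 1) 0 ^ 2 =
      (s 1 - s 0) / (s 2 - s 0) * ((1 - 2 * u - u / s 1 * s 0) / (1 - u / s 1)) := by
  have e : (∏ j, (g j - u / s 1 * s 0)) /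
      ((u / s 1) ^ 2 * (1 - u / s 1) * ∏ j ∈ Finset.univ.erase 0, (s j - s 0)) =
      (s 1 - s 0) / (s 2 - s 0) * ((1 - 2 * u - u / s 1 * s 0) / (1 - u / s 1)) := by
    rw [hg, show Finset.univ.erase (0 : Fin 3) = {1, 2} by decide, Finset.prod_pair (by decide)]
    have h1 : s 1 - s 0 ≠ 0 := by linarith
    have h2 : s 2 - s 0 ≠ 0 := by linarith
    have h3 : (u - u / s 1 * s 0) ^ 2 = (u / s 1) ^ 2 * (s 1 - s 0) ^ 2 := by
      field_simp
    have h4 : (u / s 1) ^ 2 ≠ 0 := pow_ne_zero _ (div_ne_zero hu hs1)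
    rw [h3, div_mul_div_comm, mul_assoc, mul_assoc, mul_div_mul_left _ _ h4, pow_two, mul_assoc,
      mul_left_comm (1 - u / s 1), mul_div_mul_left _ _ h1, mul_comm (s 2 - s 0)]
  rw [connectionNormal, e, Real.sq_sqrt]
  exact mul_nonneg (div_nonneg (by linarith) (by linarith)) hsgn

lemma connectionNormal_two_sq (hs1 : s 1 ≠ 0) (h01 : s 0 < s 1) (h12 : s 1 < s 2) (hu : u ≠ 0)
    (hg : ∀ z, ∏ j, (g j - z) = (u - z) ^ 2 * (1 - 2 * u - z))
    (hsgn : 0 ≤ (1 - 2 * u - u / s 1 * s 2) / (1 - u / s 1)) :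
    connectionNormal s g (u / s 1) 2 ^ 2 =
      (s 2 - s 1) / (s 2 - s 0) * ((1 - 2 * u - u / s 1 * s 2) / (1 - u / s 1)) := by
  have e : (∏ j, (g j - u / s 1 * s 2)) /
      ((u / s 1) ^ 2 * (1 - u / s 1) * ∏ j ∈ Finset.univ.erase 2, (s j - s 2)) =
      (s 2 - s 1) / (s 2 - s 0) * ((1 - 2 * u - u / s 1 * s 2) / (1 - u / s 1)) := by
    rw [hg, show Finset.univ.erase (2 : Fin 3) = {1, 0} by decide, Finset.prod_pair (by decide)]
    have h1 : s 2 - s 1 ≠ 0 := by linarith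
    have h3 : (u - u / s 1 * s 2) ^ 2 = (u / s 1) ^ 2 * (s 2 - s 1) ^ 2 := by
      field_simp; ring
    have h4 : (u / s 1) ^ 2 ≠ 0 := pow_ne_zero _ (div_ne_zero hu hs1)
    rw [h3, show (s 1 - s 2) * (s 0 - s 2) = (s 2 - s 1) * (s 2 - s 0) by ring,
      div_mul_div_comm, mul_assoc, mul_assoc, mul_div_mul_left _ _ h4, pow_two, mul_assoc,
      mul_left_comm (1 - u / s 1), mul_div_mul_left _ _ h1, mul_comm (s 2 - s 0)]
  rw [connectionNormal, e, Real.sq_sqrt]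
  exact mul_nonneg (div_nonneg (by linarith) (by linarith)) hsgn

/-- Along the arc the middle eigenvector of `S` stays an eigenvector, for the eigenvalue
`x = η s₁`. The product of the other two eigenvalues divided by `x` is affine in `x`. -/
lemma det_rankOneCurve_arc (hs1 : 0 < s 1) (h01 : s 0 < s 1) (h12 : s 1 < s 2)
    (hsum : s 0 + s 1 + s 2 = 1) (hu : 0 < u) (hus : u ≠ s 1)
    (hg : ∀ z, ∏ j, (g j - z) = (u - z) ^ 2 * (1 - 2 * u - z))
    (hroot : (1 - 2 * u) * (3 * u - 2 * s 1) * s 1 = s 0 * s 2 * u)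
    (hsgn0 : 0 ≤ (1 - 2 * u - u / s 1 * s 0) / (1 - u / s 1))
    (hsgn2 : 0 ≤ (1 - 2 * u - u / s 1 * s 2) / (1 - u / s 1)) (η z : ℝ) :
    (Matrix.scalar (Fin 3) z - (η • Matrix.diagonal s + (1 - η) •
      Matrix.vecMulVec (connectionNormal s g (u / s 1)) (connectionNormal s g (u / s 1)))).det =
    (z - η * s 1) * (z ^ 2 - (1 - η * s 1) * z +
      η * s 1 * ((1 - 2 * u) * (3 * u - 2 * (η * s 1)) / u)) := by
  rw [det_rankOneCurve_of_middle_zero (connectionNormal_one hs1.ne' hg),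
    connectionNormal_zero_sq hs1.ne' h01 h12 hu.ne' hg hsgn0,
    connectionNormal_two_sq hs1.ne' h01 h12 hu.ne' hg hsgn2]
  have hd : s 2 - s 0 ≠ 0 := by linarith
  have hlam : 1 - u / s 1 = (s 1 - u) / s 1 := by field_simp
  have hlam0 : s 1 - u ≠ 0 := sub_ne_zero.mpr (Ne.symm hus)
  set N := (s 1 - s 0) / (s 2 - s 0) * ((1 - 2 * u - u / s 1 * s 0) / (1 - u / s 1)) with hN
  set P := (s 2 - s 1) / (s 2 - s 0) * ((1 - 2 * u - u / s 1 * s 2) / (1 - u / s 1)) with hP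
  have hN' : N * ((s 2 - s 0) * (s 1 - u)) =
      (s 1 - s 0) * ((1 - 2 * u) * s 1 - u * s 0) := by
    rw [hN, hlam]; field_simp
  have hP' : P * ((s 2 - s 0) * (s 1 - u)) =
      (s 2 - s 1) * ((1 - 2 * u) * s 1 - u * s 2) := by
    rw [hP, hlam]; field_simp
  have hdd : (s 2 - s 0) * (s 1 - u) ≠ 0 := mul_ne_zero hd hlam0
  have hs0 : s 0 = 1 - s 1 - s 2 := by linarith
  have hNP : N + P = 1 := by
    apply mul_right_cancel₀ hdd
    rw [add_mul, hN', hP', hs0]; ring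
  have hdet : u * (η * s 0 * s 2 + (1 - η) * (N * s 2 + P * s 0)) =
      s 1 * ((1 - 2 * u) * (3 * u - 2 * (η * s 1))) := by
    apply mul_right_cancel₀ hdd
    have e : (N * s 2 + P * s 0) * ((s 2 - s 0) * (s 1 - u)) =
        s 2 * ((s 1 - s 0) * ((1 - 2 * u) * s 1 - u * s 0)) +
        s 0 * ((s 2 - s 1) * ((1 - 2 * u) * s 1 - u * s 2)) := by
      rw [← hN', ← hP']; ring
    have e2 : u * (η * s 0 * s 2 + (1 - η) * (N * s 2 + P * s 0)) *
        ((s 2 - s 0) * (s 1 - u)) = u * η * s 0 * s 2 * ((s 2 - s 0) * (s 1 - u)) +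
        u * (1 - η) * ((N * s 2 + P * s 0) * ((s 2 - s 0) * (s 1 - u))) := by ring
    rw [e2, e]
    linear_combination (u - η * s 1) * (s 2 - s 0) * hroot
  have hP1 : P = 1 - N := by linarith
  have hq : (z - η * s 0) * (z - η * s 2) - (1 - η) * (N * (z - η * s 2) + P * (z - η * s 0)) =
      z ^ 2 - (1 - η * s 1) * z + η * (η * s 0 * s 2 + (1 - η) * (N * s 2 + P * s 0)) := by
    rw [hP1, hs0]; ring
  rw [hq]
  congr 2
  rw [mul_div_assoc', eq_div_iff hu.ne']
  linear_combination η * hdet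

lemma exists_eta_eq {lam η : ℝ} (h0 : 0 < lam) (h1 : lam ≠ 1) (hη : η ∈ Set.uIcc lam 1) :
    ∃ t ∈ Set.Icc (0 : ℝ) 1, eta lam t = η := by
  have hη0 : 0 < η := lt_of_lt_of_le (lt_min h0 one_pos) hη.1
  have h1' : 1 - lam ≠ 0 := sub_ne_zero.mpr (Ne.symm h1)
  refine ⟨lam * (1 - η) / (η * (1 - lam)), ?_, ?_⟩
  · rcases lt_or_gt_of_ne h1 with h | h
    · rw [Set.uIcc_of_le h.le] at hη
      have hd : 0 < η * (1 - lam) := mul_pos hη0 (by linarith)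
      refine ⟨div_nonneg (mul_nonneg h0.le (by linarith [hη.2])) hd.le, ?_⟩
      rw [div_le_one hd]
      linarith [hη.1]
    · rw [Set.uIcc_of_ge h.le] at hη
      have hd : η * (1 - lam) < 0 := mul_neg_of_pos_of_neg hη0 (by linarith)
      refine ⟨div_nonneg_of_nonpos (mul_nonpos_of_nonneg_of_nonpos h0.le (by linarith [hη.1]))
        hd.le, ?_⟩
      rw [div_le_one_of_neg hd]
      linarith [hη.2]
  · unfold eta
    have : lam + lam * (1 - η) / (η * (1 - lam)) * (1 - lam) = lam / η := by
      field_simp; ring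
    rw [this]; field_simp

lemma eta_mem_uIcc {lam t : ℝ} (h0 : 0 < lam) (ht : t ∈ Set.Icc (0 : ℝ) 1) :
    eta lam t ∈ Set.uIcc lam 1 := by
  rcases le_total lam 1 with h | h
  · rw [Set.uIcc_of_le h]; exact eta_mem_of_lt_one h0 h ht
  · rw [Set.uIcc_of_ge h]; exact eta_mem_of_one_lt h ht

lemma gap_eq_of_monotone_of_sum {m : Fin 3 → ℝ} (hm : Monotone m) (hsum : m 0 + m 1 + m 2 = 1)
    (u : ℝ) : gap u m = u * (m 0 * m 2) - m 1 * ((1 - 2 * u) * (3 * u - 2 * m 1)) := by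
  rw [gap_eq_of_monotone hm, gapAt]
  have : m 0 = 1 - m 1 - m 2 := by linarith
  rw [this]; ring

/-- A rank-one arc ending at a uniaxial matrix of parameter `u` is the part of the zero set of the
gap of parameter `u` on which the middle entry lies between `u` and `s₁`. -/
theorem mem_eigenvalueCurve_iff (hs1 : 0 < s 1) (h01 : s 0 < s 1) (h12 : s 1 < s 2)
    (hsum : s 0 + s 1 + s 2 = 1) (hu : 0 < u) (hus : u ≠ s 1)
    (hg : ∀ z, ∏ j, (g j - z) = (u - z) ^ 2 * (1 - 2 * u - z))
    (hroot : (1 - 2 * u) * (3 * u - 2 * s 1) * s 1 = s 0 * s 2 * u)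
    (hsgn0 : 0 ≤ (1 - 2 * u - u / s 1 * s 0) / (1 - u / s 1))
    (hsgn2 : 0 ≤ (1 - 2 * u - u / s 1 * s 2) / (1 - u / s 1))
    (hside : ∀ x ∈ Set.uIcc u (s 1), (u - x) * (1 - 3 * u) ≤ 0) {m : Fin 3 → ℝ} :
    m ∈ eigenvalueCurve s g (u / s 1) ↔
      Monotone m ∧ m 0 + m 1 + m 2 = 1 ∧ m 1 ∈ Set.uIcc u (s 1) ∧ gap u m = 0 := by
  have hlam : 0 < u / s 1 := div_pos hu hs1
  have hlam1 : u / s 1 ≠ 1 := by rwa [Ne, div_eq_one_iff_eq hs1.ne']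
  have hscale : ∀ η, η ∈ Set.uIcc (u / s 1) 1 ↔ η * s 1 ∈ Set.uIcc u (s 1) := by
    intro η
    rw [Set.mem_uIcc, Set.mem_uIcc, div_le_iff₀ hs1, le_div_iff₀ hs1,
      ← mul_le_mul_iff_left₀ hs1 (b := η) (c := 1), ← mul_le_mul_iff_left₀ hs1 (b := 1) (c := η),
      one_mul]
  constructor
  · rintro ⟨t, ht, hM⟩
    rw [isOrderedEigenvalues_iff] at hM
    obtain ⟨hm, hdet⟩ := hM
    have hη := eta_mem_uIcc hlam ht
    rw [hscale] at hη
    have hz : ∀ z, (z - eta (u / s 1) t * s 1) * (z ^ 2 - (1 - eta (u / s 1) t * s 1) * z +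
        eta (u / s 1) t * s 1 * ((1 - 2 * u) * (3 * u - 2 * (eta (u / s 1) t * s 1)) / u)) =
        (z - m 0) * (z - m 1) * (z - m 2) := by
      intro z
      rw [← hdet z]
      exact (det_rankOneCurve_arc hs1 h01 h12 hsum hu hus hg hroot hsgn0 hsgn2 _ z).symm
    set x := eta (u / s 1) t * s 1 with hx
    clear_value x
    set P := x * ((1 - 2 * u) * (3 * u - 2 * x) / u) with hP
    have hPu : u * P = x * ((1 - 2 * u) * (3 * u - 2 * x)) := by
      rw [hP]; field_simp
    clear_value P
    have hx0 : 0 < x := lt_of_lt_of_le (lt_min hu hs1) hη.1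
    -- at `z = x` the quadratic factor is nonpositive, so that `x` is the middle root
    have hr : x ^ 2 - (1 - x) * x + P ≤ 0 := by
      have e : u * (x ^ 2 - (1 - x) * x + P) = 2 * x * ((u - x) * (1 - 3 * u)) := by
        rw [mul_add, hPu]; ring
      have : u * (x ^ 2 - (1 - x) * x + P) ≤ 0 := by
        rw [e]; exact mul_nonpos_of_nonneg_of_nonpos (by linarith) (hside x hη)
      exact nonpos_of_mul_nonpos_right this hu
    have hm01 : m 0 ≤ m 1 := hm (by decide)
    have hm12 : m 1 ≤ m 2 := hm (by decide)
    have z0 := hz 0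
    have z1 := hz 1
    have z2 := hz (-1)
    have hsumm : m 0 + m 1 + m 2 = 1 := by
      linear_combination (1 / 2) * z1 + (1 / 2) * z2 - z0
    have he2 : m 0 * m 1 + m 0 * m 2 + m 1 * m 2 = P + x * (1 - x) := by
      linear_combination (-1 / 2) * z1 + (1 / 2) * z2
    have hx1 : x = m 1 := by
      have hroots := hz x
      rw [sub_self, zero_mul, eq_comm, mul_eq_zero, mul_eq_zero] at hroots
      rcases hroots with (h | h) | h
      · by_contra hne
        have hx' : x = m 0 := by linarith
        have hlt : x < m 1 := lt_of_le_of_ne (by linarith) hne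
        have e : x ^ 2 - (1 - x) * x + P = (m 1 - x) * (m 2 - x) := by
          have h2 : m 2 = 1 - x - m 1 := by linarith
          rw [← hx', h2] at he2
          rw [h2]; linear_combination -he2
        have : 0 < (m 1 - x) * (m 2 - x) := mul_pos (by linarith) (by linarith)
        linarith
      · linarith
      · by_contra hne
        have hx' : x = m 2 := by linarith
        have hlt : m 1 < x := lt_of_le_of_ne (by linarith) (Ne.symm hne)
        have e : x ^ 2 - (1 - x) * x + P = (x - m 1) * (x - m 0) := by
          have h2 : m 0 = 1 - x - m 1 := by linarith
          rw [← hx', h2] at he2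
          rw [h2]; linear_combination -he2
        have : 0 < (x - m 1) * (x - m 0) := mul_pos (by linarith) (by linarith)
        linarith
    refine ⟨hm, hsumm, hx1 ▸ hη, ?_⟩
    rw [gap_eq_of_monotone_of_sum hm hsumm, ← hx1, ← hPu]
    have : m 0 * m 2 = P := by
      rw [← hx1] at he2 hsumm
      linear_combination he2 - x * hsumm
    rw [this]; ring
  · rintro ⟨hm, hsumm, hx, hgap⟩
    have hη : m 1 / s 1 ∈ Set.uIcc (u / s 1) 1 := by
      rw [hscale, div_mul_cancel₀ _ hs1.ne']; exact hx
    obtain ⟨t, ht, hteq⟩ := exists_eta_eq hlam hlam1 hη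
    refine ⟨t, ht, ?_⟩
    rw [isOrderedEigenvalues_iff]
    refine ⟨hm, fun z => ?_⟩
    rw [rankOneCurve, hteq, det_rankOneCurve_arc hs1 h01 h12 hsum hu hus hg hroot hsgn0 hsgn2,
      div_mul_cancel₀ _ hs1.ne']
    rw [gap_eq_of_monotone_of_sum hm hsumm] at hgap
    have : m 1 * ((1 - 2 * u) * (3 * u - 2 * m 1) / u) = m 0 * m 2 := by
      rw [mul_div_assoc', div_eq_iff hu.ne']; linear_combination -hgap
    rw [this, show 1 - m 1 = m 0 + m 2 by linarith]; ring

end Arc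

section Gamma

variable {s m : Fin 3 → ℝ}

/-- The equation `quadB s u = 0` says that the line of parameter `u` passes through `s`. -/
lemma quadB_root {u : ℝ} (h : quadB s u = 0) :
    (1 - 2 * u) * (3 * u - 2 * s 1) * s 1 = s 0 * s 2 * u := by
  unfold quadB at h; linear_combination -h

lemma mem_GammaAlpha_iff (h_pos : 0 < s 0) (h_lt : s 0 < s 1) (h_lt' : s 1 < s 2)
    (h_sum : s 0 + s 1 + s 2 = 1) :
    m ∈ GammaAlpha s ↔ Monotone m ∧ m 0 + m 1 + m 2 = 1 ∧ (uAlpha s ≤ m 1 ∧ m 1 ≤ s 1) ∧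
      gap (uAlpha s) m = 0 := by
  obtain ⟨h0, h3, -, -, hfac⟩ := uAlpha_uBeta_spec h_pos h_lt h_lt' h_sum
  have hs1 : 0 < s 1 := by linarith
  have hmid := (mem_Ioo_of_quadB_neg h_pos h_lt h_lt' h_sum
    (quadB_neg_middle h_lt h_lt' h_pos h_sum)).1
  have hlow := (mem_Ioo_of_quadB_neg h_pos h_lt h_lt' h_sum
    (quadB_neg_low h_lt h_lt' h_pos h_sum)).1
  have hroot := quadB_root (u := uAlpha s) (by rw [hfac]; ring)
  set u := uAlpha s with hu
  have hlam : u / s 1 < 1 := (div_lt_one hs1).mpr hmid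
  have h2 : u / s 1 * s 2 ≤ 1 - 2 * u := by
    rw [div_mul_eq_mul_div, div_le_iff₀ hs1]
    have hpos : 0 < 3 * u - 2 * s 1 := by
      have h1 : 0 < (3 * u - 2 * s 1) * ((1 - 2 * u) * s 1) := by
        have : 0 < s 0 * s 2 * u := mul_pos (mul_pos h_pos (by linarith)) h0
        linarith
      exact pos_of_mul_pos_left h1 (mul_pos (by linarith) hs1).le
    have h1 : (3 * u - 2 * s 1) * (u * s 2) ≤ s 0 * (u * s 2) :=
      mul_le_mul_of_nonneg_right (by linarith) (mul_pos h0 (by linarith)).le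
    refine le_of_mul_le_mul_left ?_ hpos
    linarith
  have h20 : u / s 1 * s 0 ≤ u / s 1 * s 2 :=
    mul_le_mul_of_nonneg_left (by linarith) (div_pos h0 hs1).le
  rw [GammaAlpha, ← Set.mem_Icc, ← Set.uIcc_of_le hmid.le]
  refine mem_eigenvalueCurve_iff hs1 h_lt h_lt' h_sum h0 hmid.ne ?_ hroot
    (div_nonneg (by linarith) (by linarith)) (div_nonneg (by linarith) (by linarith)) ?_
  · intro z
    rw [Fin.prod_univ_three]
    simp [UAlpha, ← hu, -mul_eq_mul_right_iff]; ring
  · intro x hx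
    rw [Set.uIcc_of_le hmid.le] at hx
    exact mul_nonpos_of_nonpos_of_nonneg (by linarith [hx.1]) (by linarith)

lemma mem_GammaBeta_iff (h_pos : 0 < s 0) (h_lt : s 0 < s 1) (h_lt' : s 1 < s 2)
    (h_sum : s 0 + s 1 + s 2 = 1) :
    m ∈ GammaBeta s ↔ Monotone m ∧ m 0 + m 1 + m 2 = 1 ∧ (s 1 ≤ m 1 ∧ m 1 ≤ uBeta s) ∧
      gap (uBeta s) m = 0 := by
  obtain ⟨-, -, h3, h4, hfac⟩ := uAlpha_uBeta_spec h_pos h_lt h_lt' h_sum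
  have hs1 : 0 < s 1 := by linarith
  have hmid := (mem_Ioo_of_quadB_neg h_pos h_lt h_lt' h_sum
    (quadB_neg_middle h_lt h_lt' h_pos h_sum)).2
  have hhigh := (mem_Ioo_of_quadB_neg h_pos h_lt h_lt' h_sum
    (quadB_neg_high h_lt h_lt' h_pos h_sum)).2
  have hroot := quadB_root (u := uBeta s) (by rw [hfac]; ring)
  set u := uBeta s with hu
  have h0 : 0 < u := by linarith
  have hlam : 1 < u / s 1 := (one_lt_div hs1).mpr hmid
  have h2 : 1 - 2 * u ≤ u / s 1 * s 0 := by
    rw [div_mul_eq_mul_div, le_div_iff₀ hs1]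
    have hpos : 0 < 3 * u - 2 * s 1 := by linarith
    have h1 : s 2 * (u * s 0) ≤ (3 * u - 2 * s 1) * (u * s 0) :=
      mul_le_mul_of_nonneg_right (by linarith) (mul_pos h0 (by linarith)).le
    refine le_of_mul_le_mul_left ?_ hpos
    linarith
  have h20 : u / s 1 * s 0 ≤ u / s 1 * s 2 :=
    mul_le_mul_of_nonneg_left (by linarith) (div_pos h0 hs1).le
  rw [GammaBeta, ← Set.mem_Icc, ← Set.uIcc_of_ge hmid.le]
  refine mem_eigenvalueCurve_iff hs1 h_lt h_lt' h_sum h0 hmid.ne' ?_ hroot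
    (div_nonneg_of_nonpos (by linarith) (by linarith))
    (div_nonneg_of_nonpos (by linarith) (by linarith)) ?_
  · intro z
    rw [Fin.prod_univ_three]
    simp [UBeta, ← hu, -mul_eq_mul_left_iff]; ring
  · intro x hx
    rw [Set.uIcc_of_ge hmid.le] at hx
    exact mul_nonpos_of_nonneg_of_nonpos (by linarith [hx.2]) (by linarith)

end Gamma

/-! ### Contraction towards the isotropic triple -/

/-- The image of `m` under the homothety of ratio `r` centred at the isotropic triple. -/
def contraction (r : ℝ) (m : Fin 3 → ℝ) : Fin 3 → ℝ := fun i => 1 / 3 + r * (m i - 1 / 3)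

lemma contraction_comp (r : ℝ) (m : Fin 3 → ℝ) (σ : Equiv.Perm (Fin 3)) :
    contraction r (m ∘ σ) = contraction r m ∘ σ := rfl

lemma contraction_sum {r : ℝ} {m : Fin 3 → ℝ} (hm : m 0 + m 1 + m 2 = 1) :
    contraction r m 0 + contraction r m 1 + contraction r m 2 = 1 := by
  unfold contraction; linear_combination r * hm

lemma contraction_monotone {r : ℝ} (hr : 0 ≤ r) {m : Fin 3 → ℝ} (hm : Monotone m) :
    Monotone (contraction r m) := fun i j hij => by
  have := mul_le_mul_of_nonneg_left (sub_le_sub_right (hm hij) (1 / 3)) hr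
  simp only [contraction]; linarith

lemma gap_contraction_of_monotone {r : ℝ} (hr : 0 ≤ r) {m : Fin 3 → ℝ} (hm : Monotone m)
    (hsum : m 0 + m 1 + m 2 = 1) (u : ℝ) :
    gap u (contraction r m) = 2 * (1 - 3 * u) ^ 2 / 9 +
      (2 - 3 * u) * (2 / 3 * (1 - 3 * u)) * (m 1 - 1 / 3) * r +
      (u * (m 0 * m 1 + m 0 * m 2 + m 1 * m 2 - 1 / 3) +
        (2 - 3 * u) * (m 1 - 1 / 3) ^ 2) * r ^ 2 := by
  rw [gap_eq_of_monotone (contraction_monotone hr hm), gapAt, contraction_sum hsum]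
  have : m 0 = 1 - m 1 - m 2 := by linarith
  simp only [contraction, this]; ring

/-- The gap is a quadratic polynomial along the rays from the isotropic triple. Either it is concave
or increasing, or else `u < 1/3` and it is nonpositive where the middle entry vanishes. -/
lemma gap_contraction_nonneg {u r : ℝ} (hu : 0 < u) (hu' : u < 1 / 2) (hr : 0 ≤ r) (hr' : r ≤ 1)
    {m : Fin 3 → ℝ} (hm : Monotone m) (hsum : m 0 + m 1 + m 2 = 1) (hpos : 0 < m 1)
    (h : 0 ≤ gap u m) : 0 ≤ gap u (contraction r m) := by
  have hm01 : m 0 ≤ m 1 := hm (by decide)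
  have hm12 : m 1 ≤ m 2 := hm (by decide)
  have h1 : contraction 1 m = m := by
    funext i; simp [contraction]
  have hG1 := gap_contraction_of_monotone zero_le_one hm hsum u
  rw [h1] at hG1
  have hG := fun {r : ℝ} (hr : 0 ≤ r) => gap_contraction_of_monotone hr hm hsum u
  set d := m 1 - 1 / 3 with hd
  set q := u * (m 0 * m 1 + m 0 * m 2 + m 1 * m 2 - 1 / 3) + (2 - 3 * u) * d ^ 2 with hq
  have hg0 : 0 ≤ 2 * (1 - 3 * u) ^ 2 / 9 := by positivity
  rcases le_or_gt q 0 with hq0 | hq0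
  · have e : gap u (contraction r m) = r * gap u m +
        (1 - r) * (2 * (1 - 3 * u) ^ 2 / 9) + (-q) * (r * (1 - r)) := by
      rw [hG1, hG hr]; ring
    rw [e]
    exact add_nonneg (add_nonneg (mul_nonneg hr h) (mul_nonneg (by linarith) hg0))
      (mul_nonneg (by linarith) (mul_nonneg hr (by linarith)))
  · rcases le_or_gt 0 ((1 - 3 * u) * d) with hs | hs
    · rw [hG hr]
      have : 0 ≤ (2 - 3 * u) * (2 / 3) * ((1 - 3 * u) * d) * r :=
        mul_nonneg (mul_nonneg (mul_nonneg (by linarith) (by norm_num)) hs) hr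
      have h3 : 0 ≤ q * r ^ 2 := mul_nonneg hq0.le (sq_nonneg r)
      linarith
    · have he : m 0 * m 1 + m 0 * m 2 + m 1 * m 2 - 1 / 3 =
          -(3 * d ^ 2) - (m 2 - m 1) * (m 2 - 1 / 3 + 2 * d) := by
        have : m 0 = 1 - m 1 - m 2 := by linarith
        rw [hd, this]; ring
      rcases mul_neg_iff.mp hs with ⟨hu3, hd0⟩ | ⟨hu3, hd0⟩
      · by_contra hcon
        push Not at hcon
        have hdr : 0 < -(3 * d) := by linarith
        set R := 1 / (-(3 * d)) with hR
        have hRd : R * d = -1 / 3 := by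
          have : d ≠ 0 := hd0.ne
          rw [hR]; field_simp
        have hR1 : 1 < R := by
          rw [hR, one_lt_div hdr]; linarith
        have hGR : gap u (contraction R m) ≤ 0 := by
          have hmon := contraction_monotone (show 0 ≤ R by linarith) hm
          have hz : contraction R m 1 = 0 := by
            simp only [contraction, ← hd, hRd]; norm_num
          rw [gap_eq_of_monotone hmon, gapAt, hz]
          have a1 : contraction R m 0 ≤ 0 := hz ▸ hmon (show (0 : Fin 3) ≤ 1 by decide)
          have a2 : 0 ≤ contraction R m 2 := by
            have := hmon (show (1 : Fin 3) ≤ 2 by decide)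
            rwa [hz] at this
          have a3 : u * (contraction R m 0 * contraction R m 2) ≤ 0 :=
            mul_nonpos_of_nonneg_of_nonpos hu.le (mul_nonpos_of_nonpos_of_nonneg a1 a2)
          linarith
        have key : (R - 1) * gap u (contraction r m) + (1 - r) * gap u (contraction R m) -
            (R - r) * gap u m = q * ((R - 1) * (1 - r) * (R - r)) := by
          rw [hG1, hG hr, hG (show 0 ≤ R by linarith)]; ring
        have k1 : (R - 1) * gap u (contraction r m) < 0 :=
          mul_neg_of_pos_of_neg (by linarith) hcon
        have k2 : (1 - r) * gap u (contraction R m) ≤ 0 :=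
          mul_nonpos_of_nonneg_of_nonpos (by linarith) hGR
        have k3 : 0 ≤ (R - r) * gap u m := mul_nonneg (by linarith) h
        have k4 : 0 ≤ q * ((R - 1) * (1 - r) * (R - r)) :=
          mul_nonneg hq0.le (mul_nonneg (mul_nonneg (by linarith) (by linarith)) (by linarith))
        linarith
      · exfalso
        have k1 : 0 ≤ u * ((m 2 - m 1) * (m 2 - 1 / 3 + 2 * d)) :=
          mul_nonneg hu.le (mul_nonneg (by linarith) (by linarith))
        have k2 : (1 - 3 * u) * d ^ 2 ≤ 0 :=
          mul_nonpos_of_nonpos_of_nonneg hu3.le (sq_nonneg d)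
        rw [he] at hq
        linarith

/-! ### The enclosed set -/

/-- The triples of positive entries, of unit sum and of nonnegative gaps of parameters `a`, `b`. -/
def gapSet (a b : ℝ) : Set (Fin 3 → ℝ) :=
  {m | m 0 + m 1 + m 2 = 1 ∧ (∀ i, 0 < m i) ∧ 0 ≤ gap a m ∧ 0 ≤ gap b m}

lemma comp_perm_mem_gapSet {m : Fin 3 → ℝ} {a b : ℝ} (h : m ∈ gapSet a b)
    (σ : Equiv.Perm (Fin 3)) : m ∘ σ ∈ gapSet a b := by
  obtain ⟨h1, h2, h3, h4⟩ := h
  refine ⟨by rw [sum_comp_perm, h1], fun i => h2 (σ i), ?_, ?_⟩ <;> rwa [gap_comp_perm]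

lemma comp_perm_comp_inv {m : Fin 3 → ℝ} (σ : Equiv.Perm (Fin 3)) :
    (m ∘ σ) ∘ (σ⁻¹ : Equiv.Perm (Fin 3)) = m := by
  funext k; simp

lemma comp_perm_mem_gapSet_iff {m : Fin 3 → ℝ} {a b : ℝ} (σ : Equiv.Perm (Fin 3)) :
    m ∘ σ ∈ gapSet a b ↔ m ∈ gapSet a b := by
  refine ⟨fun h => ?_, fun h => comp_perm_mem_gapSet h σ⟩
  have := comp_perm_mem_gapSet h σ⁻¹
  rwa [comp_perm_comp_inv] at this

section GapSet

variable {a b r : ℝ} {m : Fin 3 → ℝ}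

lemma contraction_mem_gapSet (ha : 0 < a) (ha' : a < 1 / 2) (hb : 0 < b) (hb' : b < 1 / 2)
    (hr : 0 ≤ r) (hr' : r ≤ 1) (hm : m ∈ gapSet a b) : contraction r m ∈ gapSet a b := by
  obtain ⟨σ, hσ⟩ := exists_perm_monotone m
  rw [← comp_perm_mem_gapSet_iff σ] at hm ⊢
  rw [← contraction_comp]
  obtain ⟨h1, h2, h3, h4⟩ := hm
  refine ⟨contraction_sum h1, fun i => ?_, gap_contraction_nonneg ha ha' hr hr' hσ h1 (h2 1) h3,
    gap_contraction_nonneg hb hb' hr hr' hσ h1 (h2 1) h4⟩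
  simp only [contraction]
  rcases hr'.eq_or_lt with h | h
  · rw [h]; linarith [h2 i]
  · linarith [mul_nonneg hr (h2 i).le]

/-- The entries of the triples in `gapSet a b` are bounded away from zero, so that positivity is both
an open and a closed condition on this set. -/
lemma gapSet_entry_gt (ha : 0 < a) (ha' : a < 1 / 3) (hb : 1 / 3 < b) (hb' : b < 1 / 2)
    (hm : m ∈ gapSet a b) (i : Fin 3) : a * (1 - 2 * b) < m i := by
  suffices key : ∀ p ∈ gapSet a b, Monotone p → a * (1 - 2 * b) < p 0 by
    obtain ⟨σ, hσ⟩ := exists_perm_monotone m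
    have h1 := key _ (comp_perm_mem_gapSet hm σ) hσ
    have h2 := hσ (Fin.zero_le (σ⁻¹ i))
    have h3 := congrFun (comp_perm_comp_inv (m := m) σ) i
    rw [Function.comp_apply] at h3
    rw [h3] at h2
    exact lt_of_lt_of_le h1 h2
  rintro p ⟨h1, h2, h3, h4⟩ hp
  have hp01 : p 0 ≤ p 1 := hp (by decide)
  have hp12 : p 1 ≤ p 2 := hp (by decide)
  have hxa : a ≤ p 1 := by
    rw [gap_eq_of_monotone hp] at h3
    have := mul_sum_le_middle hp01 hp12 ha ha' (h2 1) h3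
    rwa [h1, mul_one] at this
  have hxb : p 1 ≤ b := by
    rw [gap_eq_of_monotone hp] at h4
    have := middle_le_mul_sum hp01 hp12 hb (h2 1) h4
    rwa [h1, mul_one] at this
  rw [gap_eq_of_monotone_of_sum hp h1] at h4
  have e1 : a * ((1 - 2 * b) * b) ≤ p 1 * ((1 - 2 * b) * (3 * b - 2 * p 1)) := by
    refine mul_le_mul hxa (mul_le_mul_of_nonneg_left (by linarith) (by linarith)) ?_ (h2 1).le
    exact mul_nonneg (by linarith) (by linarith)
  have e2 : b * (a * (1 - 2 * b)) ≤ b * (p 0 * p 2) := by linarith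
  have e3 : a * (1 - 2 * b) ≤ p 0 * p 2 := le_of_mul_le_mul_left e2 (by linarith)
  have e4 : p 0 * p 2 < p 0 * 1 :=
    mul_lt_mul_of_pos_left (by linarith [h2 0, h2 1]) (h2 0)
  linarith

lemma gapSet_subset_closedBall : gapSet a b ⊆ Metric.closedBall 0 1 := by
  rintro m ⟨h1, h2, -, -⟩
  rw [mem_closedBall_zero_iff, pi_norm_le_iff_of_nonneg zero_le_one]
  intro i
  rw [Real.norm_of_nonneg (h2 i).le]
  have := h2 0
  have := h2 1
  have := h2 2
  fin_cases i <;> simp <;> linarith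

lemma continuous_gap (u : ℝ) : Continuous (gap u) := by
  unfold gap gapAt med; fun_prop

/-- For triples of unit sum the two gaps, suitably scaled, differ by a multiple of
`s₁ - m₁`, where `s₁ = 3 a b`. -/
lemma gap_sub_gap (hm : Monotone m) (hsum : m 0 + m 1 + m 2 = 1) :
    a * gap b m - b * gap a m = 2 * m 1 * (b - a) * (3 * (a * b) - m 1) := by
  rw [gap_eq_of_monotone_of_sum hm hsum, gap_eq_of_monotone_of_sum hm hsum]; ring

end GapSet

section Enclosed

variable {s m : Fin 3 → ℝ}

/-- Vieta's formula for the product of the roots of `quadB s`; it places the intersection of the two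
lines at middle entry `s₁`. -/
lemma middle_eq_mul_roots (h_pos : 0 < s 0) (h_lt : s 0 < s 1) (h_lt' : s 1 < s 2)
    (h_sum : s 0 + s 1 + s 2 = 1) : 3 * (uAlpha s * uBeta s) = s 1 := by
  obtain ⟨-, -, -, -, hfac⟩ := uAlpha_uBeta_spec h_pos h_lt h_lt' h_sum
  have h := hfac 0
  unfold quadB at h
  have h2 : s 1 * (3 * (uAlpha s * uBeta s)) = s 1 * s 1 := by linarith
  exact mul_left_cancel₀ (by linarith : s 1 ≠ 0) h2

lemma GammaAlpha_subset (h_pos : 0 < s 0) (h_lt : s 0 < s 1) (h_lt' : s 1 < s 2)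
    (h_sum : s 0 + s 1 + s 2 = 1) : GammaAlpha s ⊆ gapSet (uAlpha s) (uBeta s) := by
  intro m hm
  rw [mem_GammaAlpha_iff h_pos h_lt h_lt' h_sum] at hm
  obtain ⟨hm, hsum, ⟨hx, hx'⟩, hgap⟩ := hm
  obtain ⟨h0, h3, h4, h5, hfac⟩ := uAlpha_uBeta_spec h_pos h_lt h_lt' h_sum
  have hroot := quadB_root (s := s) (u := uAlpha s) (by rw [hfac]; ring)
  have hsub := gap_sub_gap (a := uAlpha s) (b := uBeta s) hm hsum
  rw [middle_eq_mul_roots h_pos h_lt h_lt' h_sum, hgap, mul_zero, sub_zero] at hsub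
  set a := uAlpha s
  set b := uBeta s
  have hs1 : 0 < s 1 := by linarith
  have hm01 : m 0 ≤ m 1 := hm (by decide)
  have hm12 : m 1 ≤ m 2 := hm (by decide)
  have hm1 : 0 < m 1 := by linarith
  have hprod : 0 < m 0 * m 2 := by
    rw [gap_eq_of_monotone_of_sum hm hsum] at hgap
    have hpos : 0 < 3 * a - 2 * s 1 := by
      have h1 : 0 < (3 * a - 2 * s 1) * ((1 - 2 * a) * s 1) := by
        have : 0 < s 0 * s 2 * a := mul_pos (mul_pos h_pos (by linarith)) h0
        linarith
      exact pos_of_mul_pos_left h1 (mul_pos (by linarith) hs1).le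
    have h1 : 0 < m 1 * ((1 - 2 * a) * (3 * a - 2 * m 1)) :=
      mul_pos hm1 (mul_pos (by linarith) (by linarith))
    exact pos_of_mul_pos_right (by linarith : 0 < a * (m 0 * m 2)) h0.le
  have hm0 : 0 < m 0 := pos_of_mul_pos_left hprod (by linarith)
  refine ⟨hsum, fun i => lt_of_lt_of_le hm0 (hm (Fin.zero_le i)), hgap.ge, ?_⟩
  have : 0 ≤ a * gap b m := by
    rw [hsub]
    exact mul_nonneg (mul_nonneg (by linarith) (by linarith)) (by linarith)
  exact nonneg_of_mul_nonneg_right this h0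

lemma GammaBeta_subset (h_pos : 0 < s 0) (h_lt : s 0 < s 1) (h_lt' : s 1 < s 2)
    (h_sum : s 0 + s 1 + s 2 = 1) : GammaBeta s ⊆ gapSet (uAlpha s) (uBeta s) := by
  intro m hm
  rw [mem_GammaBeta_iff h_pos h_lt h_lt' h_sum] at hm
  obtain ⟨hm, hsum, ⟨hx, hx'⟩, hgap⟩ := hm
  obtain ⟨h0, h3, h4, h5, hfac⟩ := uAlpha_uBeta_spec h_pos h_lt h_lt' h_sum
  have hsub := gap_sub_gap (a := uAlpha s) (b := uBeta s) hm hsum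
  rw [middle_eq_mul_roots h_pos h_lt h_lt' h_sum, hgap, mul_zero, zero_sub] at hsub
  set a := uAlpha s
  set b := uBeta s
  have hm01 : m 0 ≤ m 1 := hm (by decide)
  have hm12 : m 1 ≤ m 2 := hm (by decide)
  have hm1 : 0 < m 1 := by linarith
  have hb : 0 < b := by linarith
  have hprod : 0 < m 0 * m 2 := by
    rw [gap_eq_of_monotone_of_sum hm hsum] at hgap
    have h1 : 0 < m 1 * ((1 - 2 * b) * (3 * b - 2 * m 1)) :=
      mul_pos hm1 (mul_pos (by linarith) (by linarith))
    exact pos_of_mul_pos_right (by linarith : 0 < b * (m 0 * m 2)) hb.le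
  have hm0 : 0 < m 0 := pos_of_mul_pos_left hprod (by linarith)
  refine ⟨hsum, fun i => lt_of_lt_of_le hm0 (hm (Fin.zero_le i)), ?_, hgap.ge⟩
  have h1 : 0 ≤ 2 * m 1 * (b - a) * (m 1 - s 1) :=
    mul_nonneg (mul_nonneg (by linarith) (by linarith)) (by linarith)
  exact nonneg_of_mul_nonneg_right (by linarith : 0 ≤ b * gap a m) hb

lemma Gamma_subset_gapSet (h_pos : 0 < s 0) (h_lt : s 0 < s 1) (h_lt' : s 1 < s 2)
    (h_sum : s 0 + s 1 + s 2 = 1) : Gamma s ⊆ gapSet (uAlpha s) (uBeta s) := by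
  have key : ∀ (i j : Fin 3) (A : Set (Fin 3 → ℝ)), A ⊆ gapSet (uAlpha s) (uBeta s) →
      withRotations (withReflection i j A) ⊆ gapSet (uAlpha s) (uBeta s) := by
    rintro i j A hA m ⟨k, hk | hk⟩
    · exact (comp_perm_mem_gapSet_iff _).mp (hA hk)
    · exact (comp_perm_mem_gapSet_iff _).mp ((comp_perm_mem_gapSet_iff _).mp (hA hk))
  exact Set.union_subset (key _ _ _ (GammaAlpha_subset h_pos h_lt h_lt' h_sum))
    (key _ _ _ (GammaBeta_subset h_pos h_lt h_lt' h_sum))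

lemma mem_withRotations_withReflection {i j : Fin 3} {A : Set (Fin 3 → ℝ)}
    (hij : ∀ σ : Equiv.Perm (Fin 3), ∃ k : Fin 3, σ = (finRotate 3) ^ (k : ℕ) ∨
      σ = (finRotate 3) ^ (k : ℕ) * Equiv.swap i j)
    {σ : Equiv.Perm (Fin 3)} (hσ : m ∘ σ ∈ A) : m ∈ withRotations (withReflection i j A) := by
  obtain ⟨k, hk | hk⟩ := hij σ
  · exact ⟨k, Or.inl (by rwa [← hk])⟩
  · exact ⟨k, Or.inr (by rw [hk] at hσ; exact hσ)⟩

/-- Off `Γ` the two gaps are positive in the interior region. -/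
lemma gap_pos_of_notMem_Gamma (h_pos : 0 < s 0) (h_lt : s 0 < s 1) (h_lt' : s 1 < s 2)
    (h_sum : s 0 + s 1 + s 2 = 1) (hm : m ∈ gapSet (uAlpha s) (uBeta s)) (hΓ : m ∉ Gamma s) :
    0 < gap (uAlpha s) m ∧ 0 < gap (uBeta s) m := by
  obtain ⟨h0, h3, h4, h5, -⟩ := uAlpha_uBeta_spec h_pos h_lt h_lt' h_sum
  obtain ⟨σ, hσ⟩ := exists_perm_monotone m
  obtain ⟨hsum, hp, hgα, hgβ⟩ := comp_perm_mem_gapSet hm σ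
  have hsub := gap_sub_gap (a := uAlpha s) (b := uBeta s) hσ hsum
  rw [middle_eq_mul_roots h_pos h_lt h_lt' h_sum] at hsub
  have hm01 : (m ∘ σ) 0 ≤ (m ∘ σ) 1 := hσ (by decide)
  have hm12 : (m ∘ σ) 1 ≤ (m ∘ σ) 2 := hσ (by decide)
  have hc : 0 < 2 * (m ∘ σ) 1 * (uBeta s - uAlpha s) :=
    mul_pos (by linarith [hp 1]) (by linarith)
  rw [← gap_comp_perm _ m σ, ← gap_comp_perm _ m σ]
  constructor
  · refine lt_of_le_of_ne hgα fun hz => hΓ (Or.inl ?_)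
    refine mem_withRotations_withReflection (σ := σ) (by decide) ?_
    rw [mem_GammaAlpha_iff h_pos h_lt h_lt' h_sum]
    refine ⟨hσ, hsum, ⟨?_, ?_⟩, hz.symm⟩
    · rw [gap_eq_of_monotone hσ] at hgα
      have := mul_sum_le_middle hm01 hm12 h0 h3 (hp 1) hgα
      rwa [hsum, mul_one] at this
    · rw [← hz, mul_zero, sub_zero] at hsub
      have : 0 ≤ 2 * (m ∘ σ) 1 * (uBeta s - uAlpha s) * (s 1 - (m ∘ σ) 1) := by
        rw [← hsub]; exact mul_nonneg h0.le hgβ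
      linarith [nonneg_of_mul_nonneg_right this hc]
  · refine lt_of_le_of_ne hgβ fun hz => hΓ (Or.inr ?_)
    refine mem_withRotations_withReflection (σ := σ) (by decide) ?_
    rw [mem_GammaBeta_iff h_pos h_lt h_lt' h_sum]
    refine ⟨hσ, hsum, ⟨?_, ?_⟩, hz.symm⟩
    · rw [← hz, mul_zero, zero_sub] at hsub
      have h1 : 0 ≤ uBeta s * gap (uAlpha s) (m ∘ σ) := mul_nonneg (by linarith) hgα
      have : 0 ≤ 2 * (m ∘ σ) 1 * (uBeta s - uAlpha s) * ((m ∘ σ) 1 - s 1) := by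
        linarith
      linarith [nonneg_of_mul_nonneg_right this hc]
    · rw [gap_eq_of_monotone hσ] at hgβ
      have := middle_le_mul_sum hm01 hm12 h4 (hp 1) hgβ
      rwa [hsum, mul_one] at this

/-- Inside `gapSet`, a component of the complement of `Γ` cannot leave `gapSet`, whose boundary in
the plane is contained in `Γ`. -/
lemma isBounded_component_of_mem (h_pos : 0 < s 0) (h_lt : s 0 < s 1) (h_lt' : s 1 < s 2)
    (h_sum : s 0 + s 1 + s 2 = 1) (hm : m ∈ gapSet (uAlpha s) (uBeta s)) (hΓ : m ∉ Gamma s) :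
    Bornology.IsBounded (connectedComponentIn (unitTracePlane \ Gamma s) m) := by
  obtain ⟨h0, h3, h4, h5, -⟩ := uAlpha_uBeta_spec h_pos h_lt h_lt' h_sum
  set ε := uAlpha s * (1 - 2 * uBeta s) with hε
  have hε0 : 0 < ε := mul_pos h0 (by linarith)
  set K : Set (Fin 3 → ℝ) :=
    {p | (∀ i, ε ≤ p i) ∧ 0 ≤ gap (uAlpha s) p ∧ 0 ≤ gap (uBeta s) p} with hK
  set O : Set (Fin 3 → ℝ) :=
    {p | (∀ i, ε < p i) ∧ 0 < gap (uAlpha s) p ∧ 0 < gap (uBeta s) p} with hO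
  have hOK : O ⊆ K := fun p hp => ⟨fun i => (hp.1 i).le, hp.2.1.le, hp.2.2.le⟩
  have hKc : IsClosed K := by
    have h1 : IsClosed {p : Fin 3 → ℝ | ∀ i, ε ≤ p i} := by
      rw [show {p : Fin 3 → ℝ | ∀ i, ε ≤ p i} = ⋂ i, {p | ε ≤ p i} by ext; simp]
      exact isClosed_iInter fun i => isClosed_le continuous_const (continuous_apply i)
    exact h1.inter ((isClosed_le continuous_const (continuous_gap _)).inter
      (isClosed_le continuous_const (continuous_gap _)))
  have hOo : IsOpen O := by
    have h1 : IsOpen {p : Fin 3 → ℝ | ∀ i, ε < p i} := by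
      rw [show {p : Fin 3 → ℝ | ∀ i, ε < p i} = ⋂ i, {p | ε < p i} by ext; simp]
      exact isOpen_iInter_of_finite fun i => isOpen_lt continuous_const (continuous_apply i)
    exact h1.inter ((isOpen_lt continuous_const (continuous_gap _)).inter
      (isOpen_lt continuous_const (continuous_gap _)))
  have hmem : ∀ p ∈ gapSet (uAlpha s) (uBeta s), p ∉ Gamma s → p ∈ O := fun p hp hpΓ =>
    ⟨gapSet_entry_gt h0 h3 h4 h5 hp, gap_pos_of_notMem_Gamma h_pos h_lt h_lt' h_sum hp hpΓ⟩
  have hKgap : ∀ p ∈ K, p ∈ unitTracePlane → p ∈ gapSet (uAlpha s) (uBeta s) := fun p hp hp1 =>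
    ⟨hp1, fun i => lt_of_lt_of_le hε0 (hp.1 i), hp.2⟩
  have hmU : m ∈ unitTracePlane \ Gamma s := ⟨hm.1, hΓ⟩
  have hCsub := connectedComponentIn_subset (unitTracePlane \ Gamma s) m
  have hsubO : connectedComponentIn (unitTracePlane \ Gamma s) m ⊆ O := by
    refine isPreconnected_connectedComponentIn.subset_left_of_subset_union hOo
      hKc.isOpen_compl (Set.disjoint_compl_right_iff_subset.mpr hOK) ?_
      ⟨m, mem_connectedComponentIn hmU, hmem m hm hΓ⟩
    intro p hp
    by_cases hpK : p ∈ K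
    · exact Or.inl (hmem p (hKgap p hpK (hCsub hp).1) (hCsub hp).2)
    · exact Or.inr hpK
  refine Metric.isBounded_closedBall.subset (Set.Subset.trans (fun p hp => ?_)
    (gapSet_subset_closedBall (a := uAlpha s) (b := uBeta s)))
  exact hKgap p (hOK (hsubO hp)) (hCsub hp).1

/-- A point outside `gapSet` is joined to infinity, off `Γ`, by the ray pointing away from the
isotropic triple. -/
lemma not_isBounded_component_of_notMem (h_pos : 0 < s 0) (h_lt : s 0 < s 1) (h_lt' : s 1 < s 2)
    (h_sum : s 0 + s 1 + s 2 = 1) (hm1 : m ∈ unitTracePlane)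
    (hm : m ∉ gapSet (uAlpha s) (uBeta s)) :
    ¬ Bornology.IsBounded (connectedComponentIn (unitTracePlane \ Gamma s) m) := by
  obtain ⟨h0, h3, h4, h5, -⟩ := uAlpha_uBeta_spec h_pos h_lt h_lt' h_sum
  have hray : ∀ r : ℝ, 1 ≤ r → contraction r m ∉ gapSet (uAlpha s) (uBeta s) := by
    intro r hr hcon
    refine hm ?_
    have := contraction_mem_gapSet h0 (by linarith) (by linarith) h5
      (show 0 ≤ r⁻¹ by positivity) (inv_le_one_of_one_le₀ hr) hcon
    convert this using 1
    funext i
    simp only [contraction]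
    have : r ≠ 0 := by linarith
    field_simp; ring
  have hsub : (fun r => contraction r m) '' Set.Ici 1 ⊆
      connectedComponentIn (unitTracePlane \ Gamma s) m := by
    refine IsPreconnected.subset_connectedComponentIn ?_ ?_ ?_
    · refine isPreconnected_Ici.image _ (Continuous.continuousOn ?_)
      unfold contraction; fun_prop
    · exact ⟨1, Set.self_mem_Ici, by funext i; simp [contraction]⟩
    · rintro _ ⟨r, hr, rfl⟩
      exact ⟨contraction_sum hm1,
        fun h => hray r hr (Gamma_subset_gapSet h_pos h_lt h_lt' h_sum h)⟩
  obtain ⟨i, hi⟩ : ∃ i, m i ≠ 1 / 3 := by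
    by_contra hcon
    push Not at hcon
    refine hm ?_
    have hmono : Monotone m := fun i j _ => by rw [hcon i, hcon j]
    refine ⟨hm1, fun i => by rw [hcon i]; norm_num, ?_, ?_⟩ <;>
    · rw [gap_eq_of_monotone hmono, gapAt, hcon 0, hcon 1, hcon 2]
      nlinarith [sq_nonneg (1 - 3 * uAlpha s), sq_nonneg (1 - 3 * uBeta s)]
  intro hbdd
  obtain ⟨C, hC⟩ := (hbdd.subset hsub).exists_norm_le
  have hd : 0 < |m i - 1 / 3| := abs_pos.mpr (sub_ne_zero.mpr hi)
  set r := max 1 ((|C| + 1) / |m i - 1 / 3|) with hr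
  have hr1 : 1 ≤ r := le_max_left _ _
  have h1 := hC _ ⟨r, hr1, rfl⟩
  have h2 : |contraction r m i| ≤ C := (norm_le_pi_norm (contraction r m) i).trans h1
  have h3 : |C| + 1 ≤ r * |m i - 1 / 3| := by
    rw [← div_le_iff₀ hd]; exact le_max_right _ _
  have h4 : r * |m i - 1 / 3| = |contraction r m i - 1 / 3| := by
    rw [contraction, add_sub_cancel_left, abs_mul, abs_of_pos (by linarith : 0 < r)]
  have h5 := abs_sub (contraction r m i) (1 / 3)
  have h6 : |(1 / 3 : ℝ)| = 1 / 3 := by norm_num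
  linarith [le_abs_self C]

/-- The set enclosed by `Γ` is cut out of the hexagon by the two gaps. -/
theorem enclosedSet_eq_admissibleSet (h_pos : 0 < s 0) (h_lt : s 0 < s 1) (h_lt' : s 1 < s 2)
    (h_sum : s 0 + s 1 + s 2 = 1) :
    enclosedSet s = admissibleSet s (uAlpha s) (uBeta s) := by
  ext m
  have hiff : m ∈ hexagon s → ((m ∈ Gamma s ∨ (m ∈ unitTracePlane \ Gamma s ∧
      Bornology.IsBounded (connectedComponentIn (unitTracePlane \ Gamma s) m))) ↔
      m ∈ gapSet (uAlpha s) (uBeta s)) := by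
    intro hH
    have hm1 := ((mem_hexagon_iff h_lt.le h_lt'.le h_sum).mp hH).1
    constructor
    · rintro (h | ⟨-, h⟩)
      · exact Gamma_subset_gapSet h_pos h_lt h_lt' h_sum h
      · by_contra hcon
        exact not_isBounded_component_of_notMem h_pos h_lt h_lt' h_sum hm1 hcon h
    · intro h
      by_cases hΓ : m ∈ Gamma s
      · exact Or.inl hΓ
      · exact Or.inr ⟨⟨hm1, hΓ⟩, isBounded_component_of_mem h_pos h_lt h_lt' h_sum h hΓ⟩
  constructor
  · rintro ⟨hH, h⟩
    obtain ⟨-, hb⟩ := (mem_hexagon_iff h_lt.le h_lt'.le h_sum).mp hH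
    obtain ⟨h1, -, h2⟩ := (hiff hH).mp h
    exact ⟨h1, hb, h2⟩
  · rintro ⟨h1, hb, h2⟩
    have hH := (mem_hexagon_iff h_lt.le h_lt'.le h_sum).mpr ⟨h1, hb⟩
    exact ⟨hH, (hiff hH).mpr ⟨h1, fun i => lt_of_lt_of_le h_pos (hb i).1, h2⟩⟩

end Enclosed

end Polycrystal

end

theorem theorem4p2 (s : Fin 3 → ℝ) (h_pos : 0 < s 0) (h_lt : s 0 < s 1) (h_lt' : s 1 < s 2)
    (h_sum : s 0 + s 1 + s 2 = 1) :
    Polycrystal.StableUnderLamination (Polycrystal.enclosedSet s) := by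
  obtain ⟨h0, h3, h4, h5, -⟩ := Polycrystal.uAlpha_uBeta_spec h_pos h_lt h_lt' h_sum
  rw [Polycrystal.enclosedSet_eq_admissibleSet h_pos h_lt h_lt' h_sum]
  exact Polycrystal.stableUnderLamination_admissibleSet h_pos h0 h3 h4 h5
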